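/- Let $\Lambda=\mathrm{Span}_{\mathbb Z}\{e_1-e_4,\;e_2-e_4,\;e_3-e_4,\;2e_4\}\subset\mathbb R^4$ and $T=\mathbb R^4/\Lambda$. For $r>0$ consider on $T$ the flat metric $g_r=r^2(du_1^2+du_2^2+du_3^2+du_4^2)$. A $\lambda_1$-minimal isometric immersion of $(T,g_r)$ in $\mathbb S^{23}\subset\mathbb R^{24}=\mathbb C^{12}$ is a smooth isometric immersion $x:(T,g_r)\to\mathbb S^{23}$ which is minimal (its mean curvature vector in $\mathbb S^{23}$ vanishes) and all of whose coordinate functions lie in the eigenspace of the first (least positive) eigenvalue of the Laplacian of $g_r$ (the coordinate functions need not span it). Two maps $x,y:T\to\mathbb S^{23}$ are congruent if $y\circ\varphi=C\circ x$ for some isometry $\varphi$ of the flat torus $T$ and some $C\in O(24)$. For real numbers $0\le a_1\le a_2\le a_3$ with $a_1^2+a_2^2+a_3^2=\frac14$ put $$\begin{aligned}x_{a_1,a_2,a_3}(u)=\Big(&a_1e^{i\pi(u_1+u_2+u_3+u_4)},\,a_1e^{i\pi(u_1+u_2-u_3-u_4)},\,a_1e^{i\pi(u_1-u_2+u_3-u_4)},\,a_1e^{i\pi(-u_1+u_2+u_3-u_4)},\\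 &a_2e^{i\pi(u_1+u_2+u_3-u_4)},\,a_2e^{i\pi(u_1+u_2-u_3+u_4)},\,a_2e^{i\pi(u_1-u_2+u_3+u_4)},\,a_2e^{i\pi(u_1-u_2-u_3-u_4)},\\ &a_3e^{2i\pi u_1},\,a_3e^{2i\pi u_2},\,a_3e^{2i\pi u_3},\,a_3e^{2i\pi u_4}\Big).\end{aligned}$$ This is a well-defined map $T\to\mathbb S^{23}$, and the following hold. (1) Every $x_{a_1,a_2,a_3}$ is a $\lambda_1$-minimal isometric immersion of $(T,g_\pi)$ in $\mathbb S^{23}$. (2) If, for some $r>0$, $x$ is a $\lambda_1$-minimal isometric immersion of $(T,g_r)$ in $\mathbb S^{23}$, then $r=\pi$ and $x$ is congruent to some $x_{a_1,a_2,a_3}$. (3) Members of the family with different parameters $(a_1,a_2,a_3)$ are not congruent. -/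

import Mathlib

open scoped ContDiff

noncomputable section

/-- Euclidean space `ℝⁿ` with its standard inner product. -/
abbrev Euc (n : ℕ) : Type := EuclideanSpace ℝ (Fin n)

/-- The unit sphere `S^m` in `ℝ^(m+1)`. -/
abbrev UnitSphere (m : ℕ) : Type := Metric.sphere (0 : Euc (m + 1)) 1

/-- The torus `ℝⁿ / Λ`. Its distance is the quotient distance
`d([u], [v]) = inf {‖u - v + w‖ : w ∈ Λ}`, the Riemannian distance of the flat metric `|du|²`. -/
abbrev FlatTorus {n : ℕ} (Λ : AddSubgroup (Euc n)) : Type := Euc n ⧸ Λ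

/-- The lift to `ℝⁿ` of a map from the torus `ℝⁿ / Λ` to a sphere, with values in the ambient
Euclidean space. -/
def torusLift {n m : ℕ} {Λ : AddSubgroup (Euc n)} (x : FlatTorus Λ → UnitSphere m) :
    Euc n → Euc (m + 1) :=
  fun u => (x (QuotientAddGroup.mk u) : Euc (m + 1))

/-- `X` pulls the Euclidean metric back to the flat metric `r² |du|²`; in particular, if `r ≠ 0`,
`X` is an immersion. -/
def IsIsometricImmersion {n m : ℕ} (r : ℝ) (X : Euc n → Euc (m + 1)) : Prop :=
  ∀ u v w : Euc n,
    inner ℝ (fderiv ℝ X u v) (fderiv ℝ X u w) = r ^ 2 * inner ℝ v w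

/-- The normal space at `u` of an immersion into the sphere: the vectors of the ambient Euclidean
space which are orthogonal to the position vector (so, tangent to the sphere at `X u`) and to the
tangent space of the immersion. -/
def normalSpace {n m : ℕ} (X : Euc n → Euc (m + 1)) (u : Euc n) : Submodule ℝ (Euc (m + 1)) :=
  (Submodule.span ℝ {X u} ⊔ LinearMap.range (fderiv ℝ X u).toLinearMap)ᗮ

/-- The second fundamental form of an immersion into the sphere: the normal part of the second
derivative. -/
def secondFundamentalForm {n m : ℕ} (X : Euc n → Euc (m + 1)) (u v w : Euc n) : Euc (m + 1) :=
  (normalSpace X u).starProjection (fderiv ℝ (fderiv ℝ X) u v w)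

/-- The mean curvature vector in the sphere of an isometric immersion of `(ℝⁿ, r² |du|²)`: the
trace, divided by `n`, of the second fundamental form in the orthonormal frame `r⁻¹ ∂ₖ`. -/
def meanCurvature {n m : ℕ} (r : ℝ) (X : Euc n → Euc (m + 1)) (u : Euc n) : Euc (m + 1) :=
  (n : ℝ)⁻¹ • ∑ k : Fin n, secondFundamentalForm X u
    (r⁻¹ • EuclideanSpace.single k 1) (r⁻¹ • EuclideanSpace.single k 1)

/-- `f` is in the eigenspace for `μ` of the (positive) Laplace operator of `(ℝⁿ / Λ, r² |du|²)`:
a smooth function on the torus with `-Δ_g f = μ f`, where `Δ_g = r⁻² Δ` (on the lift to `ℝⁿ`). -/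
def InEigenspace {n : ℕ} (Λ : AddSubgroup (Euc n)) (r μ : ℝ) (f : FlatTorus Λ → ℝ) : Prop :=
  ContDiff ℝ ∞ (fun u : Euc n => f (QuotientAddGroup.mk u)) ∧
  ∀ u : Euc n,
    -((r ^ 2)⁻¹ * Laplacian.laplacian (fun u : Euc n => f (QuotientAddGroup.mk u)) u) =
      μ * f (QuotientAddGroup.mk u)

/-- `μ` is the first eigenvalue `λ₁` of `(ℝⁿ / Λ, r² |du|²)`: the least positive eigenvalue. -/
def IsFirstEigenvalue {n : ℕ} (Λ : AddSubgroup (Euc n)) (r μ : ℝ) : Prop :=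
  IsLeast {ν : ℝ | 0 < ν ∧ ∃ f : FlatTorus Λ → ℝ, f ≠ 0 ∧ InEigenspace Λ r ν f} μ

/-- `x` is a `λ₁`-minimal isometric immersion of the flat torus `(ℝⁿ / Λ, r² |du|²)` in `S^m`:
a smooth isometric immersion with vanishing mean curvature all of whose coordinate functions lie in
the first eigenspace of the Laplace operator. -/
structure IsLambdaOneMinimal {n m : ℕ} (Λ : AddSubgroup (Euc n)) (r : ℝ)
    (x : FlatTorus Λ → UnitSphere m) : Prop where
  smooth : ContDiff ℝ ∞ (torusLift x)
  isometric : IsIsometricImmersion r (torusLift x)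
  minimal : ∀ u, meanCurvature r (torusLift x) u = 0
  firstEigenfunctions : ∃ μ : ℝ, IsFirstEigenvalue Λ r μ ∧
    ∀ i : Fin (m + 1), InEigenspace Λ r μ (fun p => (x p : Euc (m + 1)) i)

/-- Two maps of the flat torus in `S^m` are congruent if they differ by an isometry of the sphere
(the restriction of a linear isometry of `ℝ^(m+1)`) and an isometry of the torus. The isometries of
`r² |du|²` do not depend on `r > 0`. -/
def IsCongruent {n m : ℕ} {Λ : AddSubgroup (Euc n)} (x y : FlatTorus Λ → UnitSphere m) : Prop :=
  ∃ (φ : FlatTorus Λ ≃ᵢ FlatTorus Λ) (C : Euc (m + 1) ≃ₗᵢ[ℝ] Euc (m + 1)),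
    ∀ p, (y (φ p) : Euc (m + 1)) = C (x p)

/-- The lattice `Span_ℤ {e₁ - e₄, e₂ - e₄, e₃ - e₄, 2 e₄}`. -/
def exceptionalLattice : AddSubgroup (Euc 4) :=
  AddSubgroup.closure
    {!₂[(1 : ℝ), 0, 0, -1], !₂[(0 : ℝ), 1, 0, -1], !₂[(0 : ℝ), 0, 1, -1], !₂[(0 : ℝ), 0, 0, 2]}

/-- The moduli of the twelve complex coordinates. -/
def familyModulus (a₁ a₂ a₃ : ℝ) : Fin 12 → ℝ :=
  ![a₁, a₁, a₁, a₁, a₂, a₂, a₂, a₂, a₃, a₃, a₃, a₃]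

/-- The arguments of the twelve complex coordinates. -/
def familyPhase (u : Euc 4) : Fin 12 → ℝ :=
  ![Real.pi * (u 0 + u 1 + u 2 + u 3),
    Real.pi * (u 0 + u 1 - u 2 - u 3),
    Real.pi * (u 0 - u 1 + u 2 - u 3),
    Real.pi * (-u 0 + u 1 + u 2 - u 3),
    Real.pi * (u 0 + u 1 + u 2 - u 3),
    Real.pi * (u 0 + u 1 - u 2 + u 3),
    Real.pi * (u 0 - u 1 + u 2 + u 3),
    Real.pi * (u 0 - u 1 - u 2 - u 3),
    2 * Real.pi * u 0, 2 * Real.pi * u 1, 2 * Real.pi * u 2, 2 * Real.pi * u 3]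

/-- The point of `ℂ¹² = ℝ²⁴` whose `j`-th complex coordinate is `familyModulus j * exp (i θ)` with
`θ = familyPhase u j`; the real and the imaginary part of the coordinate `j` are the real
coordinates `2 j` and `2 j + 1`. -/
def familyPoint (a₁ a₂ a₃ : ℝ) (u : Euc 4) : Euc 24 :=
  WithLp.toLp 2 fun i : Fin 24 =>
    let j : Fin 12 := i.divNat (m := 12) (n := 2)
    let z : ℂ := (familyModulus a₁ a₂ a₃ j : ℂ) * Complex.exp (Complex.I * (familyPhase u j : ℂ))
    if i.modNat (m := 12) (n := 2) = 0 then z.re else z.im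

/-- The parameters of the family. -/
structure IsParameter (a₁ a₂ a₃ : ℝ) : Prop where
  nonneg : 0 ≤ a₁
  le₁₂ : a₁ ≤ a₂
  le₂₃ : a₂ ≤ a₃
  sum_sq : a₁ ^ 2 + a₂ ^ 2 + a₃ ^ 2 = 1 / 4

theorem exists_familyPhase_add (v : Euc 4) (hv : v ∈ exceptionalLattice) :
    ∀ (u : Euc 4) (j : Fin 12),
      ∃ k : ℤ, familyPhase (u + v) j = familyPhase u j + k * (2 * Real.pi) := by
  induction hv using AddSubgroup.closure_induction with
  | mem v hv =>
    intro u j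
    simp only [Set.mem_insert_iff, Set.mem_singleton_iff] at hv
    rcases hv with rfl | rfl | rfl | rfl <;> fin_cases j <;>
      simp [familyPhase] <;>
      first
        | exact ⟨0, by push_cast; ring1⟩
        | exact ⟨1, by push_cast; ring1⟩
        | exact ⟨-1, by push_cast; ring1⟩
        | exact ⟨2, by push_cast; ring1⟩
  | zero => exact fun u j => ⟨0, by simp⟩
  | add x y _ _ hx hy =>
    intro u j
    obtain ⟨k, hk⟩ := hx u j
    obtain ⟨l, hl⟩ := hy (u + x) j
    exact ⟨k + l, by rw [← add_assoc, hl, hk]; push_cast; ring⟩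
  | neg x _ hx =>
    intro u j
    obtain ⟨k, hk⟩ := hx (u + -x) j
    refine ⟨-k, ?_⟩
    rw [neg_add_cancel_right] at hk
    rw [hk]; push_cast; ring

theorem familyPoint_add (a₁ a₂ a₃ : ℝ) (u v : Euc 4) (hv : v ∈ exceptionalLattice) :
    familyPoint a₁ a₂ a₃ (u + v) = familyPoint a₁ a₂ a₃ u := by
  have key : ∀ j, Complex.exp (Complex.I * (familyPhase (u + v) j : ℂ)) =
      Complex.exp (Complex.I * (familyPhase u j : ℂ)) := by
    intro j
    obtain ⟨k, hk⟩ := exists_familyPhase_add v hv u j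
    rw [hk, Complex.exp_eq_exp_iff_exists_int]
    exact ⟨k, by push_cast; ring1⟩
  simp only [familyPoint, key]

theorem familyPoint_norm {a₁ a₂ a₃ : ℝ} (h : IsParameter a₁ a₂ a₃) (u : Euc 4) :
    familyPoint a₁ a₂ a₃ u ∈ Metric.sphere (0 : Euc 24) 1 := by
  have hz : ∀ (a t : ℝ), ((a : ℂ) * Complex.exp (Complex.I * (t : ℂ))).re ^ 2 +
      ((a : ℂ) * Complex.exp (Complex.I * (t : ℂ))).im ^ 2 = a ^ 2 := by
    intro a t
    rw [mul_comm Complex.I, Complex.re_ofReal_mul, Complex.im_ofReal_mul,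
      Complex.exp_ofReal_mul_I_re, Complex.exp_ofReal_mul_I_im]
    linear_combination a ^ 2 * Real.cos_sq_add_sin_sq t
  have hsum : ∑ i, familyPoint a₁ a₂ a₃ u i ^ 2 = ∑ j, familyModulus a₁ a₂ a₃ j ^ 2 := by
    have e := (finProdFinEquiv (m := 12) (n := 2)).sum_comp
      (fun i => familyPoint a₁ a₂ a₃ u i ^ 2)
    refine e.symm.trans ?_
    rw [Fintype.sum_prod_type]
    refine Finset.sum_congr rfl fun j _ => ?_
    rw [Fin.sum_univ_two, ← hz (familyModulus a₁ a₂ a₃ j) (familyPhase u j)]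
    have d : ∀ k : Fin 2, (finProdFinEquiv (j, k)).divNat = j := fun k =>
      congrArg Prod.fst (finProdFinEquiv.symm_apply_apply (j, k))
    have m : ∀ k : Fin 2, (finProdFinEquiv (j, k)).modNat = k := fun k =>
      congrArg Prod.snd (finProdFinEquiv.symm_apply_apply (j, k))
    simp only [familyPoint, d, m]
    simp
  rw [mem_sphere_zero_iff_norm, EuclideanSpace.norm_eq]
  simp only [Real.norm_eq_abs, sq_abs]
  rw [hsum, Real.sqrt_eq_one]
  simp only [Fin.sum_univ_succ, familyModulus]
  simp
  linear_combination 4 * h.sum_sq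

/-- The family of maps of the exceptional torus in `S²³`. -/
def exceptionalFamily {a₁ a₂ a₃ : ℝ} (h : IsParameter a₁ a₂ a₃) :
    FlatTorus exceptionalLattice → UnitSphere 23 :=
  fun p => Quotient.liftOn' p
    (fun u => (⟨familyPoint a₁ a₂ a₃ u, familyPoint_norm h u⟩ : UnitSphere 23))
    (by
      intro u v huv
      have h1 := QuotientAddGroup.leftRel_apply.mp huv
      have h2 := familyPoint_add a₁ a₂ a₃ u _ h1
      apply Subtype.ext
      simpa using h2.symm)

end

/-! The lattice is D₄. Waves on the torus are exp(iπ⟨k, u⟩) with k an integer vector whose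
coordinates all have the same parity (k/2 runs over the dual lattice), with eigenvalue π²|k|²/r².
The least nonzero value of |k|² is 4, so λ₁ = 4π²/r², and λ₁-eigenfunctions are combinations of the
waves of the 24 short vectors (±1, ±1, ±1, ±1) and ±2eᵢ, the vertices of a 24-cell. Up to sign these
are twelve vectors forming three orthogonal frames. Each frame satisfies ∑ ⟨k, v⟩⟨k, w⟩ = 4⟨v, w⟩,
which makes the family isometric; minimality is Takahashi's argument (`meanCurvature_eq_zero`).

For the classification, write X = ∑ c_k exp(iπ⟨k, u⟩) with vector coefficients. Comparing Fourier
coefficients in |X|² = 1 and in the isometry equations gives, for every q ≠ 0, linear relations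
among the products c_k · c_l with k + l = q. The geometry of the pairs of short vectors with a given
sum forces c_k · c_l = 0 unless l = -k (`eq_zero_of_sum_fiber`). Hence ⟨X(u), X(v)⟩ depends only on
the weights |c_k|². The frequency-zero equations give r = π and weights constant on each frame
(`IsLambdaOneMinimal.exists_kernel`). This kernel determines X up to a linear isometry, and
isometries preserving the lattice permute the three frames, so the weights can be sorted
(`canSort`).

Distinct parameters are separated by metric data alone. The points of the torus farthest from a
given point are the three deep holes of D₄, translated; any isometry permutes such triples. At these
holes the kernel is 8aᵢ² - 1, so the sorted parameters can be read off. -/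

noncomputable section

open MeasureTheory UnitAddTorus

/-! ### Fourier series of functions periodic for 2ℤⁿ -/

/-- The projection of `ℝⁿ` to the torus `(ℝ / 2ℤ)ⁿ`, rescaled to the unit torus. -/
def toTorus {n : ℕ} (u : Euc n) : UnitAddTorus (Fin n) := fun i => ((u i / 2 : ℝ) : UnitAddCircle)

theorem isOpenQuotientMap_toTorus {n : ℕ} : IsOpenQuotientMap (toTorus (n := n)) := by
  have h1 : IsOpenQuotientMap (fun x : ℝ => ((x / 2 : ℝ) : UnitAddCircle)) :=
    (QuotientAddGroup.isOpenQuotientMap_mk (N := AddSubgroup.zmultiples (1 : ℝ))).comp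
      (Homeomorph.mulRight₀ (2⁻¹ : ℝ) (by norm_num)).isOpenQuotientMap
  exact (IsOpenQuotientMap.piMap fun _ : Fin n => h1).comp
    (EuclideanSpace.equiv (Fin n) ℝ).toHomeomorph.isOpenQuotientMap

theorem toTorus_add {n : ℕ} (u v : Euc n) : toTorus (u + v) = toTorus u + toTorus v := by
  funext i
  simp [toTorus, add_div]

/-- The pairing of an integer vector with a vector. -/
def latticePairing {n : ℕ} (k : Fin n → ℤ) (u : Euc n) : ℝ := ∑ i, (k i : ℝ) * u i

/-- The exponential `u ↦ exp (i π ⟨k, u⟩)`. -/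
def expWave {n : ℕ} (k : Fin n → ℤ) (u : Euc n) : ℂ :=
  Complex.exp (Complex.I * ((Real.pi * latticePairing k u : ℝ) : ℂ))

theorem mFourier_toTorus {n : ℕ} (k : Fin n → ℤ) (u : Euc n) :
    mFourier k (toTorus u) = expWave k u := by
  simp only [mFourier, ContinuousMap.coe_mk, toTorus, fourier_coe_apply, expWave, latticePairing]
  rw [← Complex.exp_sum]
  congr 1
  push_cast
  rw [Finset.mul_sum, Finset.mul_sum]
  exact Finset.sum_congr rfl fun i _ => by ring

theorem mFourier_add_apply {n : ℕ} (k : Fin n → ℤ) (s t : UnitAddTorus (Fin n)) :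
    mFourier k (s + t) = mFourier k s * mFourier k t := by
  simp [mFourier, fourier_apply, ← Finset.prod_mul_distrib, AddCircle.toCircle_add]

/-- A function on `ℝⁿ` is periodic for the lattice `2ℤⁿ`. -/
def IsTwoPeriodic {n : ℕ} (f : Euc n → ℝ) : Prop :=
  ∀ u v, toTorus u = toTorus v → f u = f v

/-- The function on the torus induced by a periodic function. -/
def torusDescend {n : ℕ} (f : Euc n → ℝ) (t : UnitAddTorus (Fin n)) : ℝ :=
  f (Function.surjInv isOpenQuotientMap_toTorus.surjective t)

theorem torusDescend_toTorus {n : ℕ} {f : Euc n → ℝ} (hf : IsTwoPeriodic f) (u : Euc n) :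
    torusDescend f (toTorus u) = f u :=
  hf _ _ (Function.surjInv_eq isOpenQuotientMap_toTorus.surjective _)

theorem continuous_torusDescend {n : ℕ} {f : Euc n → ℝ} (hf : IsTwoPeriodic f)
    (hc : Continuous f) : Continuous (torusDescend f) := by
  rw [isOpenQuotientMap_toTorus.isQuotientMap.continuous_iff]
  exact hc.congr fun u => (torusDescend_toTorus hf u).symm

/-- The Fourier coefficients of a periodic function. -/
def waveCoeff {n : ℕ} (f : Euc n → ℝ) (k : Fin n → ℤ) : ℂ :=
  mFourierCoeff (fun t => (torusDescend f t : ℂ)) k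

/-- The normalized Haar measure of the torus. -/
abbrev torusMeasure (n : ℕ) : Measure (UnitAddTorus (Fin n)) :=
  Measure.pi fun _ => AddCircle.haarAddCircle

theorem waveCoeff_eq_integral {n : ℕ} (f : Euc n → ℝ) (k : Fin n → ℤ) :
    waveCoeff f k = ∫ t, mFourier (-k) t * (torusDescend f t : ℂ) ∂torusMeasure n := rfl

/-- Haar measure is translation invariant and the wave is a character. This both detects extra
periods and, applied to `s • v` and differentiated in `s`, yields the coefficients of a derivative.
-/
theorem integral_translate {n : ℕ} (F : UnitAddTorus (Fin n) → ℝ) (k : Fin n → ℤ) (v : Euc n) :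
    ∫ t, mFourier (-k) t * (F (t + toTorus v) : ℂ) ∂torusMeasure n =
      expWave k v * ∫ t, mFourier (-k) t * (F t : ℂ) ∂torusMeasure n := by
  rw [← integral_const_mul, ← integral_add_right_eq_self (μ := torusMeasure n)
    (fun t => expWave k v * (mFourier (-k) t * (F t : ℂ))) (toTorus v)]
  congr 1
  funext t
  have h : mFourier k (toTorus v) * mFourier (-k) (toTorus v) = 1 := by
    rw [← mFourier_add, add_neg_cancel, mFourier_zero]; rfl
  rw [mFourier_add_apply, ← mFourier_toTorus]
  linear_combination (-(mFourier (-k) t * (F (t + toTorus v) : ℂ))) * h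

theorem torusDescend_translate {n : ℕ} {f : Euc n → ℝ} (hf : IsTwoPeriodic f) (v u : Euc n) :
    torusDescend f (toTorus u + toTorus v) = f (u + v) := by
  rw [← toTorus_add, torusDescend_toTorus hf]

/-- The Fourier coefficients of a function invariant under the translation by `v` vanish at the
frequencies whose wave is not invariant. -/
theorem waveCoeff_eq_zero_of_translate {n : ℕ} {f : Euc n → ℝ} (hf : IsTwoPeriodic f) {v : Euc n}
    (hv : ∀ u, f (u + v) = f u) {k : Fin n → ℤ} (hk : expWave k v ≠ 1) : waveCoeff f k = 0 := by
  have h := integral_translate (torusDescend f) k v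
  have h2 : ∀ t, torusDescend f (t + toTorus v) = torusDescend f t := by
    intro t
    obtain ⟨u, rfl⟩ := isOpenQuotientMap_toTorus.surjective t
    rw [torusDescend_translate hf, hv, torusDescend_toTorus hf]
  simp only [h2] at h
  rw [← waveCoeff_eq_integral] at h
  have h3 : (expWave k v - 1) * waveCoeff f k = 0 := by linear_combination -h
  exact (mul_eq_zero.mp h3).resolve_left (sub_ne_zero.mpr hk)

theorem IsTwoPeriodic.fderiv {n : ℕ} {f : Euc n → ℝ} (hf : IsTwoPeriodic f) (v : Euc n) :
    IsTwoPeriodic fun u => fderiv ℝ f u v := by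
  intro u w h
  have h1 : (fun z => f (z + (w - u))) = f := by
    funext z
    apply hf
    have : toTorus w = toTorus u + toTorus (w - u) := by rw [← toTorus_add, add_sub_cancel]
    rw [toTorus_add]
    rw [h] at this
    rw [left_eq_add.mp this, add_zero]
  change _root_.fderiv ℝ f u v = _root_.fderiv ℝ f w v
  conv_lhs => rw [← h1, fderiv_comp_add_right, add_sub_cancel]

theorem hasDerivAt_expWave_line {n : ℕ} (k : Fin n → ℤ) (v : Euc n) :
    HasDerivAt (fun s : ℝ => expWave k (s • v))
      (Complex.I * ((Real.pi * latticePairing k v : ℝ) : ℂ)) 0 := by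
  have h1 : ∀ s : ℝ, expWave k (s • v) =
      Complex.exp ((s : ℂ) * (Complex.I * ((Real.pi * latticePairing k v : ℝ) : ℂ))) := by
    intro s
    have : latticePairing k (s • v) = s * latticePairing k v := by
      simp only [latticePairing, Finset.mul_sum, PiLp.smul_apply, smul_eq_mul]
      exact Finset.sum_congr rfl fun i _ => by ring
    rw [expWave, this]
    congr 1
    push_cast
    ring
  simp only [h1]
  have h2 : HasDerivAt (fun s : ℝ => (s : ℂ) * (Complex.I * ((Real.pi * latticePairing k v : ℝ) : ℂ)))
      (1 * (Complex.I * ((Real.pi * latticePairing k v : ℝ) : ℂ))) 0 :=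
    (Complex.ofRealCLM.hasDerivAt (x := (0 : ℝ))).mul_const _
  simpa using h2.cexp

/-- The Fourier coefficients of a derivative. -/
theorem waveCoeff_fderiv {n : ℕ} {f : Euc n → ℝ} (hf : IsTwoPeriodic f) (hs : ContDiff ℝ ∞ f)
    (v : Euc n) (k : Fin n → ℤ) :
    waveCoeff (fun u => fderiv ℝ f u v) k =
      Complex.I * ((Real.pi * latticePairing k v : ℝ) : ℂ) * waveCoeff f k := by
  set f' : Euc n → ℝ := fun u => fderiv ℝ f u v with hf'
  have hp' : IsTwoPeriodic f' := hf.fderiv v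
  have hc : Continuous (torusDescend f) := continuous_torusDescend hf hs.continuous
  have hc' : Continuous (torusDescend f') := by
    refine continuous_torusDescend hp' ?_
    exact (hs.continuous_fderiv (by simp)).clm_apply continuous_const
  obtain ⟨C, hC⟩ : ∃ C, ∀ t, ‖torusDescend f' t‖ ≤ C := by
    obtain ⟨C, hC⟩ := isCompact_univ.exists_bound_of_continuousOn hc'.continuousOn
    exact ⟨C, fun t => hC t trivial⟩
  -- The coefficient of the translate of `f` by `s • v` is differentiated at `s = 0` in two ways:
  -- under the integral sign, and through the factor `expWave k (s • v)`.
  have key := hasDerivAt_integral_of_dominated_loc_of_deriv_le (μ := torusMeasure n) (𝕜 := ℝ)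
    (F := fun s t => mFourier (-k) t * (torusDescend f (t + toTorus (s • v)) : ℂ))
    (F' := fun s t => mFourier (-k) t * (torusDescend f' (t + toTorus (s • v)) : ℂ))
    (x₀ := (0 : ℝ)) (s := Set.univ) (bound := fun _ => C) Filter.univ_mem ?_ ?_ ?_ ?_ ?_ ?_
  · have h2 := key.2
    simp only [integral_translate] at h2
    have h3 := (hasDerivAt_expWave_line k v).mul_const
      (∫ t, mFourier (-k) t * (torusDescend f t : ℂ) ∂torusMeasure n)
    have h4 := h2.unique h3
    simp only [zero_smul] at h4
    rw [waveCoeff_eq_integral, waveCoeff_eq_integral, ← h4]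
    simp [expWave, latticePairing]
  · refine Filter.Eventually.of_forall fun s => Continuous.aestronglyMeasurable ?_
    fun_prop
  · refine Continuous.integrable_of_hasCompactSupport ?_ (HasCompactSupport.of_compactSpace _)
    fun_prop
  · refine Continuous.aestronglyMeasurable ?_
    fun_prop
  · refine Filter.Eventually.of_forall fun t s _ => ?_
    rw [norm_mul, Complex.norm_real]
    have : ‖mFourier (-k) t‖ ≤ 1 := by
      simpa [mFourier_norm] using (mFourier (-k)).norm_coe_le_norm t
    calc _ ≤ 1 * C := mul_le_mul this (hC _) (norm_nonneg _) zero_le_one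
      _ = C := one_mul C
  · exact integrable_const C
  · refine Filter.Eventually.of_forall fun t s _ => ?_
    obtain ⟨u, rfl⟩ := isOpenQuotientMap_toTorus.surjective t
    simp only [torusDescend_translate hf, torusDescend_translate hp']
    have h1 : HasDerivAt (fun s : ℝ => u + s • v) v s := by
      simpa using ((hasDerivAt_id s).smul_const v).const_add u
    have h2 : HasDerivAt (fun s : ℝ => f (u + s • v)) (f' (u + s • v)) s :=
      ((hs.differentiable (by simp)) _).hasFDerivAt.comp_hasDerivAt s h1
    exact (Complex.ofRealCLM.hasFDerivAt.comp_hasDerivAt s h2).const_mul _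

/-- A periodic function with finitely many nonzero Fourier coefficients is a trigonometric
polynomial. -/
theorem eq_sum_waveCoeff {n : ℕ} {f : Euc n → ℝ} (hf : IsTwoPeriodic f) (hc : Continuous f)
    (S : Finset (Fin n → ℤ)) (hS : ∀ k ∉ S, waveCoeff f k = 0) (u : Euc n) :
    (f u : ℂ) = ∑ k ∈ S, waveCoeff f k * expWave k u := by
  let F : C(UnitAddTorus (Fin n), ℂ) :=
    ⟨fun t => (torusDescend f t : ℂ),
      Complex.continuous_ofReal.comp (continuous_torusDescend hf hc)⟩
  have hsum : Summable (mFourierCoeff F) := summable_of_ne_finset_zero (s := S) hS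
  have h := hasSum_mFourier_series_apply_of_summable hsum (toTorus u)
  have h2 : HasSum (fun k => mFourierCoeff F k • mFourier k (toTorus u))
      (∑ k ∈ S, mFourierCoeff F k • mFourier k (toTorus u)) :=
    hasSum_sum_of_ne_finset_zero fun k hk => by
      rw [show mFourierCoeff F k = 0 from hS k hk, zero_smul]
  have h3 := h.unique h2
  simp only [mFourier_toTorus, smul_eq_mul] at h3
  rw [← torusDescend_toTorus hf u]
  exact h3

/-! ### The lattice as D₄, and the parity of its frequencies -/

theorem mem_exceptionalLattice_iff (v : Euc 4) :
    v ∈ exceptionalLattice ↔ ∃ k : Fin 4 → ℤ, Even (∑ i, k i) ∧ ∀ i, v i = k i := by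
  constructor
  · intro hv
    induction hv using AddSubgroup.closure_induction with
    | mem v hv =>
      simp only [Set.mem_insert_iff, Set.mem_singleton_iff] at hv
      rcases hv with rfl | rfl | rfl | rfl
      · exact ⟨![1, 0, 0, -1], by decide, fun i => by fin_cases i <;> simp⟩
      · exact ⟨![0, 1, 0, -1], by decide, fun i => by fin_cases i <;> simp⟩
      · exact ⟨![0, 0, 1, -1], by decide, fun i => by fin_cases i <;> simp⟩
      · exact ⟨![0, 0, 0, 2], by decide, fun i => by fin_cases i <;> simp⟩
    | zero => exact ⟨0, by simp, by simp⟩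
    | add x y _ _ hx hy =>
      obtain ⟨k, hk, hk'⟩ := hx
      obtain ⟨l, hl, hl'⟩ := hy
      exact ⟨k + l, by simpa [Finset.sum_add_distrib] using hk.add hl,
        fun i => by simp [hk', hl']⟩
    | neg x _ hx =>
      obtain ⟨k, hk, hk'⟩ := hx
      exact ⟨-k, by simpa using hk, fun i => by simp [hk']⟩
  · rintro ⟨k, ⟨m, hm⟩, hk⟩
    simp only [Fin.sum_univ_four] at hm
    have hm' : (k 0 + k 1 + k 2 + k 3 : ℝ) = m + m := by exact_mod_cast hm
    have e : v = k 0 • !₂[(1 : ℝ), 0, 0, -1] + k 1 • !₂[(0 : ℝ), 1, 0, -1] +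
        k 2 • !₂[(0 : ℝ), 0, 1, -1] + m • !₂[(0 : ℝ), 0, 0, 2] := by
      ext i
      fin_cases i
      · simp [hk]
      · simp [hk]
      · simp [hk]
      · simp [hk]
        linarith
    rw [e]
    refine add_mem (add_mem (add_mem ?_ ?_) ?_) ?_ <;>
      exact zsmul_mem (AddSubgroup.subset_closure (by simp)) _

theorem torusFunction_add {f : FlatTorus exceptionalLattice → ℝ} (u : Euc 4) {v : Euc 4}
    (hv : v ∈ exceptionalLattice) :
    f (QuotientAddGroup.mk (u + v)) = f (QuotientAddGroup.mk u) :=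
  congrArg f (QuotientAddGroup.mk_add_of_mem u hv)

/-- The lattice contains 2ℤ⁴, so Fourier analysis on the product torus applies; the remaining
periods only restrict the frequencies. -/
theorem isTwoPeriodic_of_torusFunction (f : FlatTorus exceptionalLattice → ℝ) :
    IsTwoPeriodic fun u : Euc 4 => f (QuotientAddGroup.mk u) := by
  intro u v h
  have h1 : ∀ i, ∃ k : ℤ, v i - u i = 2 * k := by
    intro i
    have h2 := congrFun h i
    simp only [toTorus] at h2
    rw [QuotientAddGroup.eq_iff_sub_mem] at h2
    obtain ⟨k, hk⟩ := h2
    refine ⟨-k, ?_⟩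
    simp only [zsmul_eq_mul, mul_one] at hk
    push_cast
    linarith
  choose k hk using h1
  have hm : v - u ∈ exceptionalLattice := by
    rw [mem_exceptionalLattice_iff]
    exact ⟨fun i => 2 * k i, by rw [← Finset.mul_sum]; exact even_two_mul _,
      fun i => by simp [hk]⟩
  simpa using (torusFunction_add (f := f) u hm).symm

/-- All coordinates of an integer vector have the same parity. -/
def SameParity (k : Fin 4 → ℤ) : Prop := ∀ i j, Even (k i - k j)

theorem expWave_eq_one_iff {n : ℕ} (k : Fin n → ℤ) (v : Euc n) {m : ℤ}
    (h : latticePairing k v = m) : expWave k v = 1 ↔ Even m := by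
  rw [expWave, Complex.exp_eq_one_iff, h]
  have hpi : (Real.pi : ℂ) ≠ 0 := by exact_mod_cast Real.pi_ne_zero
  constructor
  · rintro ⟨l, hl⟩
    refine ⟨l, ?_⟩
    have h1 : (m : ℂ) = (l + l : ℤ) := by
      push_cast at hl ⊢
      apply mul_left_cancel₀ (mul_ne_zero Complex.I_ne_zero hpi)
      linear_combination hl
    exact_mod_cast h1
  · rintro ⟨l, rfl⟩
    exact ⟨l, by push_cast; ring⟩

/-- The difference of two standard basis vectors is a period, and its wave value is 1 only when the
corresponding coordinates of `k` are congruent mod 2. -/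
theorem sameParity_of_waveCoeff_ne_zero {f : FlatTorus exceptionalLattice → ℝ} {k : Fin 4 → ℤ}
    (h : waveCoeff (fun u : Euc 4 => f (QuotientAddGroup.mk u)) k ≠ 0) : SameParity k := by
  intro i j
  let v : Euc 4 := EuclideanSpace.single i 1 - EuclideanSpace.single j 1
  have hv : v ∈ exceptionalLattice := by
    rw [mem_exceptionalLattice_iff]
    refine ⟨Pi.single i 1 - Pi.single j 1, ?_, fun l => ?_⟩
    · simp
    · simp [v, Pi.single_apply]
  have hp : latticePairing k v = (k i - k j : ℤ) := by
    simp [latticePairing, v, mul_sub, Finset.sum_sub_distrib]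
  rw [← expWave_eq_one_iff k v hp]
  by_contra hk
  exact h (waveCoeff_eq_zero_of_translate (isTwoPeriodic_of_torusFunction f)
    (fun u => torusFunction_add u hv) hk)

/-! ### Fourier coefficients of eigenfunctions -/

theorem laplacian_eq_sum_fderiv {n : ℕ} {F : Type*} [NormedAddCommGroup F] [NormedSpace ℝ F]
    (f : Euc n → F) (u : Euc n) :
    Laplacian.laplacian f u = ∑ i, fderiv ℝ (fderiv ℝ f) u
      (EuclideanSpace.single i 1) (EuclideanSpace.single i 1) := by
  rw [InnerProductSpace.laplacian_eq_iteratedFDeriv_orthonormalBasis f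
    (EuclideanSpace.basisFun (Fin n) ℝ)]
  refine Finset.sum_congr rfl fun i _ => ?_
  rw [iteratedFDeriv_two_apply]
  simp

theorem fderiv_fderiv_apply {n : ℕ} {F : Type*} [NormedAddCommGroup F] [NormedSpace ℝ F]
    {f : Euc n → F} (hf : ContDiff ℝ ∞ f) (u v w : Euc n) :
    fderiv ℝ (fderiv ℝ f) u v w = fderiv ℝ (fun z => fderiv ℝ f z w) u v := by
  have hd : DifferentiableAt ℝ (fderiv ℝ f) u :=
    (hf.fderiv_right (m := ∞) (by simp)).differentiable (by simp) u
  rw [fderiv_clm_apply hd (differentiableAt_const w)]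
  simp

theorem contDiff_fderiv_apply {n : ℕ} {F : Type*} [NormedAddCommGroup F] [NormedSpace ℝ F]
    {f : Euc n → F} (hf : ContDiff ℝ ∞ f) (v : Euc n) :
    ContDiff ℝ ∞ fun u => fderiv ℝ f u v :=
  (hf.fderiv_right (m := ∞) (by simp)).clm_apply contDiff_const

theorem waveCoeff_sum {n : ℕ} {ι : Type*} (S : Finset ι) (f : ι → Euc n → ℝ)
    (hf : ∀ i, IsTwoPeriodic (f i)) (hc : ∀ i, Continuous (f i)) (k : Fin n → ℤ) :
    waveCoeff (fun u => ∑ i ∈ S, f i u) k = ∑ i ∈ S, waveCoeff (f i) k := by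
  simp only [waveCoeff_eq_integral]
  rw [← integral_finsetSum]
  · refine integral_congr_ae (Filter.Eventually.of_forall fun t => ?_)
    simp [torusDescend, Finset.mul_sum]
  · intro i _
    have := continuous_torusDescend (hf i) (hc i)
    refine Continuous.integrable_of_hasCompactSupport ?_ (HasCompactSupport.of_compactSpace _)
    fun_prop

theorem waveCoeff_laplacian {n : ℕ} {f : Euc n → ℝ} (hf : IsTwoPeriodic f) (hs : ContDiff ℝ ∞ f)
    (k : Fin n → ℤ) :
    waveCoeff (fun u => Laplacian.laplacian f u) k =
      -((Real.pi ^ 2 * ∑ i, (k i : ℝ) ^ 2 : ℝ) : ℂ) * waveCoeff f k := by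
  simp only [laplacian_eq_sum_fderiv, fderiv_fderiv_apply hs]
  rw [waveCoeff_sum]
  · have h1 : ∀ i, latticePairing k (EuclideanSpace.single i 1) = k i := fun i => by
      simp [latticePairing]
    simp only [waveCoeff_fderiv (hf.fderiv _) (contDiff_fderiv_apply hs _),
      waveCoeff_fderiv hf hs, h1]
    push_cast
    rw [Finset.mul_sum, ← Finset.sum_neg_distrib, Finset.sum_mul]
    refine Finset.sum_congr rfl fun i _ => ?_
    linear_combination (Real.pi ^ 2 * (k i) ^ 2 * waveCoeff f k : ℂ) * Complex.I_sq
  · exact fun i => (hf.fderiv _).fderiv _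
  · exact fun i => (contDiff_fderiv_apply (contDiff_fderiv_apply hs _) _).continuous

theorem waveCoeff_const_mul {n : ℕ} (f : Euc n → ℝ) (c : ℝ) (k : Fin n → ℤ) :
    waveCoeff (fun u => c * f u) k = c * waveCoeff f k := by
  simp only [waveCoeff_eq_integral]
  rw [← integral_const_mul]
  refine integral_congr_ae (Filter.Eventually.of_forall fun t => ?_)
  simp [torusDescend]
  ring

/-- The frequencies of an eigenfunction. -/
theorem InEigenspace.frequency {r ν : ℝ} (hr : 0 < r) {f : FlatTorus exceptionalLattice → ℝ}
    (h : InEigenspace exceptionalLattice r ν f) {k : Fin 4 → ℤ}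
    (hk : waveCoeff (fun u : Euc 4 => f (QuotientAddGroup.mk u)) k ≠ 0) :
    SameParity k ∧ Real.pi ^ 2 * ∑ i, (k i : ℝ) ^ 2 = ν * r ^ 2 := by
  refine ⟨sameParity_of_waveCoeff_ne_zero hk, ?_⟩
  have h1 := waveCoeff_laplacian (isTwoPeriodic_of_torusFunction f) h.1 k
  have h2 : (fun u => Laplacian.laplacian (fun u : Euc 4 => f (QuotientAddGroup.mk u)) u) =
      fun u : Euc 4 => (-(ν * r ^ 2)) * f (QuotientAddGroup.mk u) := by
    funext u
    have := h.2 u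
    have hr2 : r ^ 2 ≠ 0 := by positivity
    field_simp at this
    linear_combination -this
  rw [h2, waveCoeff_const_mul] at h1
  have h3 := mul_right_cancel₀ hk h1
  have h4 : -(ν * r ^ 2) = -(Real.pi ^ 2 * ∑ i, (k i : ℝ) ^ 2) := by exact_mod_cast h3
  linarith

/-! ### Short vectors and the lower bound for positive eigenvalues -/

/-- The integer vectors `2 w`, for `w` a shortest vector of the dual lattice. -/
def shortVectors : Finset (Fin 4 → ℤ) :=
  (Fintype.piFinset fun _ => Finset.Icc (-2) 2).filter fun k =>
    (∀ i j, Even (k i - k j)) ∧ ∑ i, k i ^ 2 = 4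

theorem mem_shortVectors {k : Fin 4 → ℤ} :
    k ∈ shortVectors ↔ SameParity k ∧ ∑ i, k i ^ 2 = 4 := by
  simp only [shortVectors, Finset.mem_filter, Fintype.mem_piFinset, Finset.mem_Icc]
  refine ⟨fun h => h.2, fun h => ⟨fun i => ?_, h⟩⟩
  have h1 : k i ^ 2 ≤ 4 := by
    rw [← h.2]
    exact Finset.single_le_sum (f := fun i => k i ^ 2) (fun j _ => sq_nonneg _) (Finset.mem_univ i)
  constructor <;> nlinarith

/-- If some coordinate is zero, all are even and a nonzero one already contributes 4; otherwise each
of the four contributes at least 1. -/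
theorem SameParity.four_le {k : Fin 4 → ℤ} (h : SameParity k) (h0 : k ≠ 0) :
    4 ≤ ∑ i, k i ^ 2 := by
  have hsq : ∀ i, k i ≠ 0 → 1 ≤ k i ^ 2 := fun i hi => by have := sq_pos_of_ne_zero hi; omega
  by_cases hz : ∃ i, k i = 0
  · obtain ⟨i, hi⟩ := hz
    obtain ⟨j, hj⟩ := Function.ne_iff.mp h0
    obtain ⟨m, hm⟩ := h j i
    have hm0 : m ≠ 0 := by rintro rfl; simp_all
    have h4 : 4 ≤ k j ^ 2 := by
      have : k j = 2 * m := by omega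
      rw [this]
      have := sq_pos_of_ne_zero hm0
      nlinarith
    exact h4.trans (Finset.single_le_sum (f := fun i => k i ^ 2) (fun j _ => sq_nonneg _)
      (Finset.mem_univ j))
  · push Not at hz
    rw [Fin.sum_univ_four]
    linarith [hsq 0 (hz 0), hsq 1 (hz 1), hsq 2 (hz 2), hsq 3 (hz 3)]

theorem InEigenspace.four_pi_sq_le {r ν : ℝ} (hr : 0 < r) (hν : 0 < ν)
    {f : FlatTorus exceptionalLattice → ℝ} (h : InEigenspace exceptionalLattice r ν f)
    (hf : f ≠ 0) : 4 * Real.pi ^ 2 ≤ ν * r ^ 2 := by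
  by_contra hlt
  apply hf
  have hz : ∀ k, waveCoeff (fun u : Euc 4 => f (QuotientAddGroup.mk u)) k = 0 := by
    intro k
    by_contra hk
    obtain ⟨h1, h2⟩ := h.frequency hr hk
    -- Frequency zero belongs to the eigenvalue 0, which `hν` excludes.
    have hk0 : k ≠ 0 := by
      rintro rfl
      have : 0 < ν * r ^ 2 := by positivity
      simp at h2
      rcases h2 with h2 | h2
      · exact hν.ne' h2
      · exact hr.ne' h2
    have h3 : (4 : ℝ) ≤ ∑ i, (k i : ℝ) ^ 2 := by exact_mod_cast h1.four_le hk0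
    nlinarith [Real.pi_pos, sq_nonneg Real.pi]
  funext p
  obtain ⟨u, rfl⟩ := QuotientAddGroup.mk_surjective p
  have := eq_sum_waveCoeff (isTwoPeriodic_of_torusFunction f) h.1.continuous ∅
    (fun k _ => hz k) u
  simpa using this

/-- The expansion of an eigenfunction for the eigenvalue `4 π² / r²`. -/
theorem InEigenspace.expansion {r ν : ℝ} (hr : 0 < r) (hν : ν * r ^ 2 = 4 * Real.pi ^ 2)
    {f : FlatTorus exceptionalLattice → ℝ} (h : InEigenspace exceptionalLattice r ν f) (u : Euc 4) :
    (f (QuotientAddGroup.mk u) : ℂ) = ∑ k ∈ shortVectors,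
      waveCoeff (fun u : Euc 4 => f (QuotientAddGroup.mk u)) k * expWave k u := by
  refine eq_sum_waveCoeff (isTwoPeriodic_of_torusFunction f) h.1.continuous _ (fun k hk => ?_) u
  by_contra hne
  obtain ⟨h1, h2⟩ := h.frequency hr hne
  refine hk (mem_shortVectors.mpr ⟨h1, ?_⟩)
  rw [hν] at h2
  have h3 : ∑ i, (k i : ℝ) ^ 2 = 4 := by
    have : Real.pi ^ 2 ≠ 0 := by positivity
    apply mul_left_cancel₀ this
    linarith
  exact_mod_cast h3

/-! ### Real waves, the first eigenvalue and the family -/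

/-- The pairing with an integer vector as a continuous linear form. -/
def pairingCLM {n : ℕ} (k : Fin n → ℤ) : Euc n →L[ℝ] ℝ :=
  ∑ i, (k i : ℝ) • (EuclideanSpace.proj i : Euc n →L[ℝ] ℝ)

theorem pairingCLM_apply {n : ℕ} (k : Fin n → ℤ) (u : Euc n) :
    pairingCLM k u = latticePairing k u := by
  simp [pairingCLM, latticePairing]

theorem contDiff_latticePairing {n : ℕ} (k : Fin n → ℤ) : ContDiff ℝ ∞ (latticePairing k) := by
  simpa only [funext (pairingCLM_apply k)] using (pairingCLM k).contDiff (n := ∞)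

theorem hasFDerivAt_latticePairing {n : ℕ} (k : Fin n → ℤ) (u : Euc n) :
    HasFDerivAt (latticePairing k) (pairingCLM k) u :=
  (pairingCLM k).hasFDerivAt.congr_of_eventuallyEq
    (Filter.Eventually.of_forall fun v => (pairingCLM_apply k v).symm)

/-- The real wave `m cos (π ⟨k, u⟩ - c)`. -/
def cosWave {n : ℕ} (m c : ℝ) (k : Fin n → ℤ) (u : Euc n) : ℝ :=
  m * Real.cos (Real.pi * latticePairing k u - c)

theorem contDiff_cosWave {n : ℕ} (m c : ℝ) (k : Fin n → ℤ) : ContDiff ℝ ∞ (cosWave m c k) :=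
  contDiff_const.mul (((contDiff_const.mul (contDiff_latticePairing k)).sub contDiff_const).cos)

theorem fderiv_cosWave {n : ℕ} (m c : ℝ) (k : Fin n → ℤ) (u v : Euc n) :
    fderiv ℝ (cosWave m c k) u v =
      cosWave (Real.pi * latticePairing k v * m) (c - Real.pi / 2) k u := by
  have h := ((((hasFDerivAt_latticePairing k u).const_mul Real.pi).sub_const c).cos).const_mul m
  have h2 : fderiv ℝ (cosWave m c k) u = _ := h.fderiv
  rw [h2, cosWave, sub_sub_eq_add_sub, add_sub_right_comm, Real.cos_add_pi_div_two]
  simp [pairingCLM_apply]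
  ring

theorem laplacian_cosWave {n : ℕ} (m c : ℝ) (k : Fin n → ℤ) (u : Euc n) :
    Laplacian.laplacian (cosWave m c k) u =
      -(Real.pi ^ 2 * ∑ i, (k i : ℝ) ^ 2) * cosWave m c k u := by
  have h1 : ∀ i, latticePairing k (EuclideanSpace.single i 1) = k i := fun i => by
    simp [latticePairing]
  rw [laplacian_eq_sum_fderiv, neg_mul, mul_assoc, Finset.sum_mul, Finset.mul_sum,
    ← Finset.sum_neg_distrib]
  refine Finset.sum_congr rfl fun i _ => ?_
  rw [fderiv_fderiv_apply (contDiff_cosWave m c k)]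
  have h2 : (fun z => fderiv ℝ (cosWave m c k) z (EuclideanSpace.single i 1)) =
      cosWave (Real.pi * latticePairing k (EuclideanSpace.single i 1) * m) (c - Real.pi / 2) k :=
    funext fun z => fderiv_cosWave m c k z _
  rw [h2, fderiv_cosWave, h1, cosWave, cosWave,
    show Real.pi * latticePairing k u - (c - Real.pi / 2 - Real.pi / 2) =
      Real.pi * latticePairing k u - c + Real.pi by ring, Real.cos_add_pi]
  ring

/-- The twelve frequencies of the family, multiplied by two. -/
def familyFrequency : Fin 12 → Fin 4 → ℤ :=
  ![![1, 1, 1, 1], ![1, 1, -1, -1], ![1, -1, 1, -1], ![-1, 1, 1, -1],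
    ![1, 1, 1, -1], ![1, 1, -1, 1], ![1, -1, 1, 1], ![1, -1, -1, -1],
    ![2, 0, 0, 0], ![0, 2, 0, 0], ![0, 0, 2, 0], ![0, 0, 0, 2]]

theorem familyPhase_eq (u : Euc 4) (j : Fin 12) :
    familyPhase u j = Real.pi * latticePairing (familyFrequency j) u := by
  fin_cases j <;> simp [familyPhase, familyFrequency, latticePairing, Fin.sum_univ_four] <;> ring

theorem familyFrequency_mem (j : Fin 12) : familyFrequency j ∈ shortVectors := by
  rw [mem_shortVectors]
  refine ⟨?_, ?_⟩ <;> revert j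
  · unfold SameParity; decide
  · decide

theorem familyPoint_apply (a₁ a₂ a₃ : ℝ) (u : Euc 4) (j : Fin 12) (k : Fin 2) :
    familyPoint a₁ a₂ a₃ u (finProdFinEquiv (j, k)) =
      cosWave (familyModulus a₁ a₂ a₃ j) (k * (Real.pi / 2)) (familyFrequency j) u := by
  have d : (finProdFinEquiv (j, k)).divNat = j :=
    congrArg Prod.fst (finProdFinEquiv.symm_apply_apply (j, k))
  have m : (finProdFinEquiv (j, k)).modNat = k :=
    congrArg Prod.snd (finProdFinEquiv.symm_apply_apply (j, k))
  simp only [familyPoint, d, m, cosWave]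
  rw [mul_comm Complex.I, Complex.re_ofReal_mul, Complex.im_ofReal_mul,
      Complex.exp_ofReal_mul_I_re, Complex.exp_ofReal_mul_I_im, familyPhase_eq]
  fin_cases k
  · simp
  · simp [Real.cos_sub_pi_div_two]

theorem contDiff_familyPoint (a₁ a₂ a₃ : ℝ) : ContDiff ℝ ∞ (familyPoint a₁ a₂ a₃) := by
  rw [contDiff_euclidean]
  intro i
  obtain ⟨⟨j, k⟩, rfl⟩ := (finProdFinEquiv (m := 12) (n := 2)).surjective i
  simp only [familyPoint_apply]
  exact contDiff_cosWave _ _ _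

theorem fderiv_apply_euc {n m : ℕ} {X : Euc n → Euc m} (hX : ContDiff ℝ ∞ X) (u v : Euc n)
    (i : Fin m) : fderiv ℝ X u v i = fderiv ℝ (fun z => X z i) u v := by
  have h := ((EuclideanSpace.proj i : Euc m →L[ℝ] ℝ).hasFDerivAt.comp u
    (hX.differentiable (by simp) u).hasFDerivAt).fderiv
  have h2 : fderiv ℝ (fun z => X z i) u = _ := h
  rw [h2]
  rfl

/-- Each group of four frequencies is an orthogonal frame of vectors of squared length 4, so it
contributes 4aᵢ² times the inner product; these factors add up to 1. -/
theorem sum_familyModulus {a₁ a₂ a₃ : ℝ} (h : IsParameter a₁ a₂ a₃) (v w : Euc 4) :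
    ∑ j, familyModulus a₁ a₂ a₃ j ^ 2 *
      (latticePairing (familyFrequency j) v * latticePairing (familyFrequency j) w) =
      inner ℝ v w := by
  simp only [Fin.sum_univ_succ, familyModulus, familyFrequency, latticePairing, PiLp.inner_apply]
  simp
  linear_combination 4 * (v 0 * w 0 + v 1 * w 1 + v 2 * w 2 + v 3 * w 3) * h.sum_sq

theorem isIsometricImmersion_familyPoint {a₁ a₂ a₃ : ℝ} (h : IsParameter a₁ a₂ a₃) :
    IsIsometricImmersion (m := 23) Real.pi (familyPoint a₁ a₂ a₃) := by
  intro u v w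
  rw [PiLp.inner_apply, ← (finProdFinEquiv (m := 12) (n := 2)).sum_comp, Fintype.sum_prod_type,
    ← sum_familyModulus h, Finset.mul_sum]
  refine Finset.sum_congr rfl fun j _ => ?_
  have h1 : ∀ (k : Fin 2) (v : Euc 4),
      (fderiv ℝ (familyPoint a₁ a₂ a₃) u) v (finProdFinEquiv (j, k)) =
        cosWave (Real.pi * latticePairing (familyFrequency j) v * familyModulus a₁ a₂ a₃ j)
          (k * (Real.pi / 2) - Real.pi / 2) (familyFrequency j) u := fun k v => by
    rw [fderiv_apply_euc (contDiff_familyPoint a₁ a₂ a₃)]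
    simp only [familyPoint_apply, fderiv_cosWave]
  simp only [Fin.sum_univ_two]
  erw [h1, h1, h1, h1]
  simp only [cosWave, RCLike.inner_apply, conj_trivial]
  simp [Real.cos_add_pi_div_two]
  linear_combination (Real.pi ^ 2 * familyModulus a₁ a₂ a₃ j ^ 2 *
      (latticePairing (familyFrequency j) v * latticePairing (familyFrequency j) w)) *
    Real.cos_sq_add_sin_sq (Real.pi * latticePairing (familyFrequency j) u)

/-- An immersion in the sphere by eigenfunctions is minimal. -/
theorem meanCurvature_eq_zero {n m : ℕ} {Λ : AddSubgroup (Euc n)} {r μ : ℝ} (hr : 0 < r)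
    {x : FlatTorus Λ → UnitSphere m} (hs : ContDiff ℝ ∞ (torusLift x))
    (h : ∀ i : Fin (m + 1), InEigenspace Λ r μ (fun p => (x p : Euc (m + 1)) i)) (u : Euc n) :
    meanCurvature r (torusLift x) u = 0 := by
  -- Takahashi's argument: the trace of the second fundamental form is the normal part of the vector
  -- Laplacian, which here is a multiple of the position vector, and the normal space is orthogonal
  -- to the latter.
  have hlap : Laplacian.laplacian (torusLift x) u = (-(μ * r ^ 2)) • torusLift x u := by
    ext i
    have h1 := (contDiff_infty.mp hs 2).contDiffAt (x := u)
    have h2 := h1.laplacian_CLM_comp_left (l := (EuclideanSpace.proj i : Euc (m + 1) →L[ℝ] ℝ))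
    have h3 := (h i).2 u
    have h4 : Laplacian.laplacian (fun u : Euc n => (x (QuotientAddGroup.mk u) : Euc (m + 1)) i) u
        = (Laplacian.laplacian (torusLift x) u) i := h2
    rw [h4] at h3
    have hr2 : r ^ 2 ≠ 0 := by positivity
    field_simp at h3
    simp only [PiLp.smul_apply, smul_eq_mul, torusLift]
    linear_combination -h3
  have h1 : meanCurvature r (torusLift x) u = ((n : ℝ)⁻¹ * (r⁻¹ * r⁻¹)) •
      (normalSpace (torusLift x) u).starProjection (Laplacian.laplacian (torusLift x) u) := by
    rw [laplacian_eq_sum_fderiv, map_sum, mul_smul, Finset.smul_sum]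
    simp only [meanCurvature, secondFundamentalForm, map_smul, smul_apply, smul_smul]
  rw [h1, hlap, map_smul]
  have h5 : (normalSpace (torusLift x) u).starProjection (torusLift x u) = 0 := by
    rw [Submodule.starProjection_apply_eq_zero_iff]
    refine Submodule.le_orthogonal_orthogonal _ ?_
    exact Submodule.mem_sup_left (Submodule.mem_span_singleton_self _)
  rw [h5, smul_zero, smul_zero]

theorem inEigenspace_of_cosWave {r : ℝ} (hr : 0 < r) {f : FlatTorus exceptionalLattice → ℝ}
    {m c : ℝ} {k : Fin 4 → ℤ} (hk : k ∈ shortVectors)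
    (hf : ∀ u : Euc 4, f (QuotientAddGroup.mk u) = cosWave m c k u) :
    InEigenspace exceptionalLattice r (4 * Real.pi ^ 2 / r ^ 2) f := by
  have hf' : (fun u : Euc 4 => f (QuotientAddGroup.mk u)) = cosWave m c k := funext hf
  have hk4 : ∑ i, (k i : ℝ) ^ 2 = 4 := by exact_mod_cast (mem_shortVectors.mp hk).2
  refine ⟨hf' ▸ contDiff_cosWave m c k, fun u => ?_⟩
  rw [hf', hf, laplacian_cosWave, hk4]
  field_simp

/-- Modulo 2, `k` is a multiple of (1, 1, 1, 1), and vectors of D₄ have even coordinate sum; so the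
pairing with `v` is even and the phase moves by a multiple of 2π. -/
theorem cosWave_add {m c : ℝ} {k : Fin 4 → ℤ} (hk : SameParity k) (u : Euc 4) {v : Euc 4}
    (hv : v ∈ exceptionalLattice) : cosWave m c k (u + v) = cosWave m c k u := by
  obtain ⟨l, ⟨q, hq⟩, hl'⟩ := (mem_exceptionalLattice_iff v).mp hv
  obtain ⟨p0, h0⟩ := hk 0 3
  obtain ⟨p1, h1⟩ := hk 1 3
  obtain ⟨p2, h2⟩ := hk 2 3
  have hp : latticePairing k (u + v) =
      latticePairing k u + 2 * (p0 * l 0 + p1 * l 1 + p2 * l 2 + k 3 * q : ℤ) := by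
    rw [Fin.sum_univ_four] at hq
    have e : k 0 * l 0 + k 1 * l 1 + k 2 * l 2 + k 3 * l 3 =
        2 * (p0 * l 0 + p1 * l 1 + p2 * l 2 + k 3 * q) := by
      linear_combination l 0 * h0 + l 1 * h1 + l 2 * h2 + k 3 * hq
    have e' : (k 0 * l 0 + k 1 * l 1 + k 2 * l 2 + k 3 * l 3 : ℝ) =
        2 * (p0 * l 0 + p1 * l 1 + p2 * l 2 + k 3 * q : ℤ) := by exact_mod_cast e
    rw [← e']
    simp only [latticePairing, Fin.sum_univ_four, PiLp.add_apply, hl']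
    ring
  rw [cosWave, cosWave, hp]
  congr 1
  rw [← Real.cos_add_int_mul_two_pi (Real.pi * latticePairing k u - c)
    (p0 * l 0 + p1 * l 1 + p2 * l 2 + k 3 * q)]
  congr 1
  ring

theorem isFirstEigenvalue_exceptionalLattice {r : ℝ} (hr : 0 < r) :
    IsFirstEigenvalue exceptionalLattice r (4 * Real.pi ^ 2 / r ^ 2) := by
  refine ⟨⟨by positivity, ?_⟩, ?_⟩
  · let f : FlatTorus exceptionalLattice → ℝ := fun p => Quotient.liftOn' p
      (cosWave 1 0 (familyFrequency 0)) (by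
        intro u v huv
        have h1 := QuotientAddGroup.leftRel_apply.mp huv
        have h2 := cosWave_add (m := 1) (c := 0)
          (mem_shortVectors.mp (familyFrequency_mem 0)).1 u h1
        simpa using h2.symm)
    refine ⟨f, fun h0 => ?_, inEigenspace_of_cosWave hr (familyFrequency_mem 0) fun u => rfl⟩
    have h1 : cosWave 1 0 (familyFrequency 0) 0 = 0 := congrFun h0 (QuotientAddGroup.mk 0)
    simp [cosWave, latticePairing] at h1
  · rintro ν ⟨hν, f, hf, h⟩
    rw [div_le_iff₀ (by positivity)]
    exact h.four_pi_sq_le hr hν hf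

theorem isLambdaOneMinimal_exceptionalFamily {a₁ a₂ a₃ : ℝ} (h : IsParameter a₁ a₂ a₃) :
    IsLambdaOneMinimal exceptionalLattice Real.pi (exceptionalFamily h) := by
  have he : ∀ i : Fin 24, InEigenspace exceptionalLattice Real.pi
      (4 * Real.pi ^ 2 / Real.pi ^ 2) (fun p => (exceptionalFamily h p : Euc 24) i) := by
    intro i
    obtain ⟨⟨j, k⟩, rfl⟩ := (finProdFinEquiv (m := 12) (n := 2)).surjective i
    exact inEigenspace_of_cosWave Real.pi_pos (familyFrequency_mem j)
      fun u => familyPoint_apply a₁ a₂ a₃ u j k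
  exact ⟨contDiff_familyPoint a₁ a₂ a₃, isIsometricImmersion_familyPoint h,
    meanCurvature_eq_zero Real.pi_pos (contDiff_familyPoint a₁ a₂ a₃) he,
    _, isFirstEigenvalue_exceptionalLattice Real.pi_pos, he⟩

/-! ### Linear independence of the waves -/

theorem latticePairing_add_right {n : ℕ} (k : Fin n → ℤ) (u v : Euc n) :
    latticePairing k (u + v) = latticePairing k u + latticePairing k v := by
  simp only [← pairingCLM_apply, map_add]

theorem latticePairing_sub_right {n : ℕ} (k : Fin n → ℤ) (u v : Euc n) :
    latticePairing k (u - v) = latticePairing k u - latticePairing k v := by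
  simp only [← pairingCLM_apply, map_sub]

theorem latticePairing_add_left {n : ℕ} (k l : Fin n → ℤ) (u : Euc n) :
    latticePairing (k + l) u = latticePairing k u + latticePairing l u := by
  simp [latticePairing, add_mul, Finset.sum_add_distrib]

theorem latticePairing_neg_left {n : ℕ} (k : Fin n → ℤ) (u : Euc n) :
    latticePairing (-k) u = -latticePairing k u := by
  simp [latticePairing]

theorem expWave_add_right {n : ℕ} (k : Fin n → ℤ) (u v : Euc n) :
    expWave k (u + v) = expWave k u * expWave k v := by
  rw [expWave, expWave, expWave, ← Complex.exp_add, latticePairing_add_right]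
  congr 1
  push_cast
  ring

theorem expWave_add_left {n : ℕ} (k l : Fin n → ℤ) (u : Euc n) :
    expWave (k + l) u = expWave k u * expWave l u := by
  rw [expWave, expWave, expWave, ← Complex.exp_add, latticePairing_add_left]
  congr 1
  push_cast
  ring

theorem expWave_zero_right {n : ℕ} (k : Fin n → ℤ) : expWave k 0 = 1 := by
  simp [expWave, latticePairing]

theorem expWave_zero_left {n : ℕ} (u : Euc n) : expWave 0 u = 1 := by
  simp [expWave, latticePairing]

theorem expWave_injective {n : ℕ} : Function.Injective (expWave (n := n)) := by
  intro k l h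
  funext i
  have h1 := hasDerivAt_expWave_line k (EuclideanSpace.single i 1)
  rw [h] at h1
  have h2 := mul_left_cancel₀ Complex.I_ne_zero
    (h1.unique (hasDerivAt_expWave_line l (EuclideanSpace.single i 1)))
  have h3 := mul_left_cancel₀ Real.pi_ne_zero (Complex.ofReal_injective h2)
  have h4 : (k i : ℝ) = l i := by simpa [latticePairing] using h3
  exact_mod_cast h4

/-- Dedekind's independence of characters, for the additive group of the Euclidean space. -/
theorem linearIndependent_expWave {n : ℕ} : LinearIndependent ℂ (expWave (n := n)) := by
  let χ : (Fin n → ℤ) → (Multiplicative (Euc n) →* ℂ) := fun k =>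
    { toFun := fun u => expWave k u.toAdd
      map_one' := expWave_zero_right k
      map_mul' := fun u v => expWave_add_right k u.toAdd v.toAdd }
  have hχ : Function.Injective χ := fun k l h => by
    apply expWave_injective
    funext u
    exact DFunLike.congr_fun h (Multiplicative.ofAdd u)
  exact (linearIndependent_monoidHom (Multiplicative (Euc n)) ℂ).comp χ hχ

/-- The coefficients of a constant trigonometric sum. -/
theorem sum_fiber_of_sum_expWave_eq {n : ℕ} {ι : Type*} (S : Finset ι) (β : ι → ℂ)
    (η : ι → Fin n → ℤ) (C : ℂ) (h : ∀ u, ∑ p ∈ S, β p * expWave (η p) u = C) (k : Fin n → ℤ) :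
    ∑ p ∈ S with η p = k, β p = if k = 0 then C else 0 := by
  classical
  -- `k` and `0` are adjoined so that the constant `C` counts as a multiple of the zero wave and the
  -- coefficient at `k` is available even when its fiber is empty.
  set T : Finset (Fin n → ℤ) := insert k (insert 0 (S.image η)) with hT
  have hm : ∀ p ∈ S, η p ∈ T := fun p hp =>
    Finset.mem_insert_of_mem (Finset.mem_insert_of_mem (Finset.mem_image_of_mem η hp))
  have h0 : (0 : Fin n → ℤ) ∈ T := Finset.mem_insert_of_mem (Finset.mem_insert_self _ _)
  have key := linearIndependent_iff'.mp (linearIndependent_expWave (n := n)) T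
    (fun l => (∑ p ∈ S with η p = l, β p) - if l = 0 then C else 0) ?_ k
    (Finset.mem_insert_self _ _)
  · exact sub_eq_zero.mp key
  · funext u
    rw [Finset.sum_apply]
    simp only [Pi.smul_apply, smul_eq_mul, sub_mul, Finset.sum_sub_distrib, Pi.zero_apply]
    have h1 : ∑ l ∈ T, (∑ p ∈ S with η p = l, β p) * expWave l u = C := by
      rw [← h u, ← Finset.sum_fiberwise_of_maps_to hm]
      refine Finset.sum_congr rfl fun l _ => ?_
      rw [Finset.sum_mul]
      refine Finset.sum_congr rfl fun p hp => ?_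
      rw [(Finset.mem_filter.mp hp).2]
    rw [h1]
    simp [ite_mul, h0, expWave_zero_left]

/-! ### Pairs of short vectors with the same sum -/

/-- The integer inner product. -/
def intDot (k l : Fin 4 → ℤ) : ℤ := ∑ i, k i * l i

theorem intDot_comm (k l : Fin 4 → ℤ) : intDot k l = intDot l k := by
  simp [intDot, mul_comm]

theorem intDot_add (k l m : Fin 4 → ℤ) : intDot k (l + m) = intDot k l + intDot k m := by
  simp [intDot, mul_add, Finset.sum_add_distrib]

theorem intDot_neg (k l : Fin 4 → ℤ) : intDot k (-l) = -intDot k l := by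
  simp [intDot]

theorem intDot_sub (k l m : Fin 4 → ℤ) : intDot k (l - m) = intDot k l - intDot k m := by
  rw [sub_eq_add_neg, intDot_add, intDot_neg, sub_eq_add_neg]

theorem intDot_self_of_mem {k : Fin 4 → ℤ} (hk : k ∈ shortVectors) : intDot k k = 4 := by
  rw [← (mem_shortVectors.mp hk).2]
  simp [intDot, sq]

theorem eq_zero_of_intDot_self {k : Fin 4 → ℤ} (h : intDot k k = 0) : k = 0 := by
  funext i
  have h1 := (Finset.sum_eq_zero_iff_of_nonneg (fun i _ => mul_self_nonneg (k i))).mp h i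
    (Finset.mem_univ i)
  simpa using h1

theorem even_intDot {k l : Fin 4 → ℤ} (hk : SameParity k) (hl : SameParity l) :
    Even (intDot k l) := by
  obtain ⟨p0, h0⟩ := hk 0 3
  obtain ⟨p1, h1⟩ := hk 1 3
  obtain ⟨p2, h2⟩ := hk 2 3
  obtain ⟨q0, h0'⟩ := hl 0 3
  obtain ⟨q1, h1'⟩ := hl 1 3
  obtain ⟨q2, h2'⟩ := hl 2 3
  refine ⟨p0 * l 0 + p1 * l 1 + p2 * l 2 + k 3 * (q0 + q1 + q2) + 2 * k 3 * l 3, ?_⟩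
  rw [intDot, Fin.sum_univ_four]
  linear_combination l 0 * h0 + l 1 * h1 + l 2 * h2 + k 3 * (h0' + h1' + h2')

/-- The squared length of `k - l` is 8 - 2⟨k, l⟩, which must be positive, and ⟨k, l⟩ is even. -/
theorem intDot_le {k l : Fin 4 → ℤ} (hk : k ∈ shortVectors) (hl : l ∈ shortVectors)
    (h : k ≠ l) : intDot k l ≤ 2 := by
  obtain ⟨m, hm⟩ := even_intDot (mem_shortVectors.mp hk).1 (mem_shortVectors.mp hl).1
  have h1 : 0 ≤ intDot (k - l) (k - l) := Finset.sum_nonneg fun i _ => mul_self_nonneg _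
  have h2 : intDot (k - l) (k - l) ≠ 0 := fun h0 =>
    h (sub_eq_zero.mp (eq_zero_of_intDot_self h0))
  have h3 : intDot (k - l) (k - l) = 8 - 2 * intDot k l := by
    rw [intDot_sub, intDot_comm, intDot_sub, intDot_comm (k - l), intDot_sub,
      intDot_self_of_mem hk, intDot_self_of_mem hl, intDot_comm l k]
    ring
  omega

theorem neg_mem_shortVectors {k : Fin 4 → ℤ} (hk : k ∈ shortVectors) : -k ∈ shortVectors := by
  rw [mem_shortVectors] at hk ⊢
  refine ⟨fun i j => ?_, by simpa using hk.2⟩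
  rw [Pi.neg_apply, Pi.neg_apply, neg_sub_neg]
  exact hk.1 j i

theorem neg_le_intDot {k l : Fin 4 → ℤ} (hk : k ∈ shortVectors) (hl : l ∈ shortVectors)
    (h : l ≠ -k) : -2 ≤ intDot k l := by
  have h1 := intDot_le hk (neg_mem_shortVectors hl) fun e => h (by rw [e, neg_neg])
  rw [intDot_neg] at h1
  omega

/-- The threshold separating a pair of short vectors from the other pairs with the same sum. -/
def pairThreshold (p : ℤ) : ℤ := if p = -2 then 16 else if p = 4 then 1 else 0

/-- A weight on the pairs of short vectors with the same sum as `(a, b)`. -/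
def pairWeight (a b c d : Fin 4 → ℤ) : ℤ :=
  -4 * (intDot c (a - b) * intDot d (a - b)) - pairThreshold (intDot a b)

/-- The product term is |a - b|⁴, equal to 16, 64 or 144 when ⟨a, b⟩ is 2, 0 or -2; the threshold 16
in the last case leaves 128. When a = b the product term vanishes, and the threshold 1 keeps the
weight nonzero. -/
theorem pairWeight_self {a b : Fin 4 → ℤ} (ha : a ∈ shortVectors) (hb : b ∈ shortVectors)
    (h : b ≠ -a) : pairWeight a b a b ≠ 0 ∧ pairWeight a b b a = pairWeight a b a b := by
  obtain ⟨m, hm⟩ := even_intDot (mem_shortVectors.mp ha).1 (mem_shortVectors.mp hb).1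
  refine ⟨?_, by simp only [pairWeight]; ring⟩
  have h1 := neg_le_intDot ha hb h
  rw [pairWeight, intDot_sub, intDot_sub, intDot_self_of_mem ha, intDot_self_of_mem hb,
    intDot_comm b a]
  by_cases hab : a = b
  · rw [hab, intDot_self_of_mem hb]
    decide
  · have h2 := intDot_le ha hb hab
    have h3 : intDot a b = -2 ∨ intDot a b = 0 ∨ intDot a b = 2 := by omega
    rcases h3 with h3 | h3 | h3 <;> rw [h3] <;> decide

/-- Since c + d = a + b is orthogonal to a - b, the product term is ⟨c - d, a - b⟩². For ⟨a, b⟩ = 0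
the differences of distinct pairs are orthogonal. For ⟨a, b⟩ = -2 they lie along the diagonals of a
cube, with inner products ±4, whence the threshold 16. For ⟨a, b⟩ = 2 or 4 there is no other pair.
-/
theorem pairWeight_other {a b c d : Fin 4 → ℤ} (ha : a ∈ shortVectors) (hb : b ∈ shortVectors)
    (hc : c ∈ shortVectors) (hd : d ∈ shortVectors) (h : b ≠ -a) (hs : c + d = a + b)
    (h1 : ¬(c = a ∧ d = b)) (h2 : ¬(c = b ∧ d = a)) : pairWeight a b c d = 0 := by
  have ea : intDot a (c + d) = intDot a (a + b) := by rw [hs]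
  have eb : intDot b (c + d) = intDot b (a + b) := by rw [hs]
  have ec : intDot c (c + d) = intDot c (a + b) := by rw [hs]
  have ed : intDot d (c + d) = intDot d (a + b) := by rw [hs]
  simp only [intDot_add, intDot_self_of_mem ha, intDot_self_of_mem hb, intDot_self_of_mem hc,
    intDot_self_of_mem hd] at ea eb ec ed
  rw [intDot_comm b a] at eb
  rw [intDot_comm d c, intDot_comm d a, intDot_comm d b] at ed
  rw [intDot_comm c a, intDot_comm c b] at ec
  have hca : c ≠ a := by
    rintro rfl
    exact h1 ⟨rfl, add_left_cancel hs⟩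
  have hda : d ≠ a := by
    rintro rfl
    rw [add_comm] at hs
    exact h2 ⟨add_left_cancel hs, rfl⟩
  have l1 := intDot_le ha hc hca.symm
  have l2 := intDot_le ha hd hda.symm
  have l3 := neg_le_intDot ha hb h
  obtain ⟨m, hm⟩ := even_intDot (mem_shortVectors.mp ha).1 (mem_shortVectors.mp hb).1
  obtain ⟨m', hm'⟩ := even_intDot (mem_shortVectors.mp ha).1 (mem_shortVectors.mp hc).1
  rw [pairWeight, intDot_sub, intDot_sub, intDot_comm c a, intDot_comm c b, intDot_comm d a,
    intDot_comm d b]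
  have e1 : intDot b c = intDot a d := by omega
  have e2 : intDot b d = intDot a c := by omega
  have e3 : intDot a d = 4 + intDot a b - intDot a c := by omega
  rw [e1, e2, e3]
  have h3 : (intDot a b = 0 ∧ intDot a c = 2) ∨ (intDot a b = -2 ∧ intDot a c = 2) ∨
      (intDot a b = -2 ∧ intDot a c = 0) := by omega
  rcases h3 with ⟨h3, h4⟩ | ⟨h3, h4⟩ | ⟨h3, h4⟩ <;> rw [h3, h4] <;> decide

/-- A symmetric function on pairs of short vectors, orthogonal on each fiber of the sum to the
constants and to the products of pairings, is supported on the pairs of opposite vectors. -/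
theorem eq_zero_of_sum_fiber {B : (Fin 4 → ℤ) → (Fin 4 → ℤ) → ℂ} (hB : ∀ a b, B a b = B b a)
    (h1 : ∀ k ≠ 0, ∑ p ∈ shortVectors ×ˢ shortVectors with p.1 + p.2 = k, B p.1 p.2 = 0)
    (h2 : ∀ k ≠ 0, ∀ l : Fin 4 → ℤ,
      ∑ p ∈ shortVectors ×ˢ shortVectors with p.1 + p.2 = k,
        B p.1 p.2 * (intDot p.1 l * intDot p.2 l : ℤ) = 0)
    {a b : Fin 4 → ℤ} (ha : a ∈ shortVectors) (hb : b ∈ shortVectors) (h : b ≠ -a) :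
    B a b = 0 := by
  classical
  have hk : a + b ≠ 0 := fun h0 => h (eq_neg_of_add_eq_zero_right h0)
  have h3 : ∑ p ∈ shortVectors ×ˢ shortVectors with p.1 + p.2 = a + b,
      B p.1 p.2 * (pairWeight a b p.1 p.2 : ℂ) = 0 := by
    -- The quadratic relation is tested on `l = a - b`, and a multiple of the constant relation is
    -- subtracted, so that only (a, b) and (b, a) survive.
    have e := congrArg₂ (fun x y : ℂ => -4 * x - pairThreshold (intDot a b) * y)
      (h2 _ hk (a - b)) (h1 _ hk)
    simp only [mul_zero, sub_zero] at e
    rw [← e, Finset.mul_sum, Finset.mul_sum, ← Finset.sum_sub_distrib]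
    refine Finset.sum_congr rfl fun p _ => ?_
    rw [pairWeight]
    push_cast
    ring
  have h4 : ∀ p ∈ (shortVectors ×ˢ shortVectors).filter (fun p => p.1 + p.2 = a + b),
      B p.1 p.2 * (pairWeight a b p.1 p.2 : ℂ) =
        if p = (a, b) ∨ p = (b, a) then B a b * (pairWeight a b a b : ℂ) else 0 := by
    rintro ⟨c, d⟩ hp
    simp only [Finset.mem_filter, Finset.mem_product] at hp
    split_ifs with hcd
    · rcases hcd with hcd | hcd <;> obtain ⟨rfl, rfl⟩ := Prod.mk.inj hcd
      · rfl
      · rw [hB, ← (pairWeight_self ha hb h).2]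
    · simp only [Prod.mk.injEq, not_or] at hcd
      rw [pairWeight_other ha hb hp.1.1 hp.1.2 h hp.2 hcd.1 hcd.2]
      simp
  rw [Finset.sum_congr rfl h4, ← Finset.sum_filter, Finset.sum_const, nsmul_eq_mul] at h3
  have h5 : (a, b) ∈ ((shortVectors ×ˢ shortVectors).filter (fun p => p.1 + p.2 = a + b)).filter
      (fun p => p = (a, b) ∨ p = (b, a)) := by
    simp [ha, hb]
  have h6 := Finset.card_ne_zero_of_mem h5
  have h7 : (pairWeight a b a b : ℂ) ≠ 0 := by exact_mod_cast (pairWeight_self ha hb h).1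
  have h8 := (mul_eq_zero.mp h3).resolve_left (by exact_mod_cast h6)
  exact (mul_eq_zero.mp h8).resolve_right h7

/-! ### Fourier form of the sphere and isometry equations -/

theorem waveCoeff_neg {n : ℕ} (f : Euc n → ℝ) (k : Fin n → ℤ) :
    waveCoeff f (-k) = (starRingEnd ℂ) (waveCoeff f k) := by
  rw [waveCoeff_eq_integral, waveCoeff_eq_integral, ← integral_conj]
  refine integral_congr_ae (Filter.Eventually.of_forall fun t => ?_)
  simp [mFourier_neg]

/-- The bilinear Gram matrix of a family of coefficients. -/
def coeffGram {m : ℕ} (c : Fin m → (Fin 4 → ℤ) → ℂ) (k l : Fin 4 → ℤ) : ℂ := ∑ i, c i k * c i l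

theorem coeffGram_comm {m : ℕ} (c : Fin m → (Fin 4 → ℤ) → ℂ) (k l : Fin 4 → ℤ) :
    coeffGram c k l = coeffGram c l k := by
  simp [coeffGram, mul_comm]

theorem ofReal_inner_eq_coeffGram {m : ℕ} {c : Fin m → (Fin 4 → ℤ) → ℂ}
    {S : Finset (Fin 4 → ℤ)} {g h : (Fin 4 → ℤ) → ℂ} {x y : Euc m}
    (hx : ∀ i, (x i : ℂ) = ∑ k ∈ S, c i k * g k) (hy : ∀ i, (y i : ℂ) = ∑ k ∈ S, c i k * h k) :
    ((inner ℝ x y : ℝ) : ℂ) = ∑ p ∈ S ×ˢ S, coeffGram c p.1 p.2 * (g p.1 * h p.2) := by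
  have h1 : ((inner ℝ x y : ℝ) : ℂ) = ∑ i, (x i : ℂ) * (y i : ℂ) := by
    rw [PiLp.inner_apply, Complex.ofReal_sum]
    refine Finset.sum_congr rfl fun i _ => ?_
    rw [RCLike.inner_apply, conj_trivial, Complex.ofReal_mul, mul_comm]
  rw [h1, Finset.sum_congr rfl fun i _ => by rw [hx i, hy i, Finset.sum_mul_sum],
    Finset.sum_product, Finset.sum_comm]
  refine Finset.sum_congr rfl fun k _ => ?_
  rw [Finset.sum_comm]
  refine Finset.sum_congr rfl fun l _ => ?_
  rw [coeffGram, Finset.sum_mul]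
  exact Finset.sum_congr rfl fun i _ => by ring

/-- The derivative of a trigonometric polynomial. -/
theorem fderiv_eq_sum_expWave {n : ℕ} {f : Euc n → ℝ} (hf : ContDiff ℝ ∞ f)
    {S : Finset (Fin n → ℤ)} {c : (Fin n → ℤ) → ℂ}
    (h : ∀ u, (f u : ℂ) = ∑ k ∈ S, c k * expWave k u) (u v : Euc n) :
    (fderiv ℝ f u v : ℂ) =
      ∑ k ∈ S, c k * (Complex.I * ((Real.pi * latticePairing k v : ℝ) : ℂ) * expWave k u) := by
  have h1 : HasDerivAt (fun s : ℝ => u + s • v) v 0 := by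
    simpa using ((hasDerivAt_id (0 : ℝ)).smul_const v).const_add u
  have hfd : HasFDerivAt f (fderiv ℝ f u) (u + (0 : ℝ) • v) := by
    rw [zero_smul, add_zero]
    exact (hf.differentiable (by simp) u).hasFDerivAt
  have h2 : HasDerivAt (fun s : ℝ => f (u + s • v)) (fderiv ℝ f u v) 0 :=
    hfd.comp_hasDerivAt 0 h1
  have h3 : HasDerivAt (fun s : ℝ => (f (u + s • v) : ℂ)) (fderiv ℝ f u v : ℂ) 0 :=
    Complex.ofRealCLM.hasFDerivAt.comp_hasDerivAt 0 h2
  have h4 : HasDerivAt (fun s : ℝ => ∑ k ∈ S, c k * (expWave k u * expWave k (s • v)))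
      (∑ k ∈ S, c k * (expWave k u * (Complex.I * ((Real.pi * latticePairing k v : ℝ) : ℂ)))) 0 :=
    HasDerivAt.fun_sum fun k _ => ((hasDerivAt_expWave_line k v).const_mul _).const_mul _
  simp only [h, expWave_add_right] at h3
  rw [h3.unique h4]
  exact Finset.sum_congr rfl fun k _ => by ring

/-- The vector with given integer coordinates. -/
def intVector (k : Fin 4 → ℤ) : Euc 4 := WithLp.toLp 2 fun i => (k i : ℝ)

theorem latticePairing_intVector (k l : Fin 4 → ℤ) :
    latticePairing k (intVector l) = intDot k l := by
  simp [latticePairing, intVector, intDot]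

/-- The squared moduli of the coefficients at the frequency `k`. -/
def coeffWeight {m : ℕ} (c : Fin m → (Fin 4 → ℤ) → ℂ) (k : Fin 4 → ℤ) : ℝ :=
  ∑ i, Complex.normSq (c i k)

theorem sum_fiber_zero (g : (Fin 4 → ℤ) → (Fin 4 → ℤ) → ℂ) :
    ∑ p ∈ shortVectors ×ˢ shortVectors with p.1 + p.2 = 0, g p.1 p.2 =
      ∑ k ∈ shortVectors, g k (-k) := by
  symm
  refine Finset.sum_bij (fun k _ => (k, -k)) ?_ ?_ ?_ ?_
  · intro k hk
    simp [hk, neg_mem_shortVectors hk]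
  · intro k _ l _ e
    exact congrArg Prod.fst e
  · rintro ⟨k, l⟩ hp
    simp only [Finset.mem_filter, Finset.mem_product] at hp
    exact ⟨k, hp.1.1, Prod.ext rfl (eq_neg_of_add_eq_zero_right hp.2).symm⟩
  · intro k _
    rfl

/-- An isometric immersion in the sphere by trigonometric polynomials with frequencies in the set
of short vectors has orthogonal coefficients, and its weights satisfy the quadratic equations of
the isometric immersions. -/
theorem coeffGram_of_isIsometricImmersion {m : ℕ} {r : ℝ} {X : Euc 4 → Euc (m + 1)}
    (hs : ContDiff ℝ ∞ X) (hiso : IsIsometricImmersion r X) (hn : ∀ u, ‖X u‖ = 1)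
    {c : Fin (m + 1) → (Fin 4 → ℤ) → ℂ}
    (hc : ∀ i u, (X u i : ℂ) = ∑ k ∈ shortVectors, c i k * expWave k u)
    (hneg : ∀ i k, c i (-k) = (starRingEnd ℂ) (c i k)) :
    (∀ k ∈ shortVectors, ∀ l ∈ shortVectors, l ≠ -k → coeffGram c k l = 0) ∧
      (∀ v w, Real.pi ^ 2 * ∑ k ∈ shortVectors,
        coeffWeight c k * (latticePairing k v * latticePairing k w) = r ^ 2 * inner ℝ v w) ∧
      ∀ u v, ((inner ℝ (X u) (X v) : ℝ) : ℂ) =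
        ∑ k ∈ shortVectors, (coeffWeight c k : ℂ) * expWave k (u - v) := by
  have hw : ∀ k, coeffGram c k (-k) = coeffWeight c k := fun k => by
    simp [coeffGram, coeffWeight, hneg, Complex.mul_conj]
  have hd : ∀ (u v : Euc 4) (i : Fin (m + 1)), ((fderiv ℝ X u v i : ℝ) : ℂ) =
      ∑ k ∈ shortVectors,
        c i k * (Complex.I * ((Real.pi * latticePairing k v : ℝ) : ℂ) * expWave k u) :=
    fun u v i => by
      rw [fderiv_apply_euc hs]
      exact fderiv_eq_sum_expWave (contDiff_euclidean.mp hs i) (hc i) u v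
  have hin : ∀ u v, ((inner ℝ (X u) (X v) : ℝ) : ℂ) =
      ∑ p ∈ shortVectors ×ˢ shortVectors,
        coeffGram c p.1 p.2 * (expWave p.1 u * expWave p.2 v) := fun u v =>
    ofReal_inner_eq_coeffGram (fun i => hc i u) (fun i => hc i v)
  -- Fourier coefficients of |X|² = 1.
  have f1 : ∀ k, ∑ p ∈ shortVectors ×ˢ shortVectors with p.1 + p.2 = k, coeffGram c p.1 p.2 =
      if k = 0 then 1 else 0 := by
    refine fun k => sum_fiber_of_sum_expWave_eq _
      (fun p : (Fin 4 → ℤ) × (Fin 4 → ℤ) => coeffGram c p.1 p.2)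
      (fun p => p.1 + p.2) 1 (fun u => ?_) k
    have := hin u u
    rw [real_inner_self_eq_norm_sq, hn, one_pow, Complex.ofReal_one] at this
    simp only [expWave_add_left]
    exact this.symm
  -- Fourier coefficients of the isometry equation for `v` and `w`; the minus sign is the square of
  -- the factor `I` from each derivative.
  have f2 : ∀ v w k, ∑ p ∈ shortVectors ×ˢ shortVectors with p.1 + p.2 = k,
      coeffGram c p.1 p.2 *
        ((-(Real.pi ^ 2 * (latticePairing p.1 v * latticePairing p.2 w)) : ℝ) : ℂ) =
      if k = 0 then ((r ^ 2 * inner ℝ v w : ℝ) : ℂ) else 0 := by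
    intro v w
    refine sum_fiber_of_sum_expWave_eq _
      (fun p : (Fin 4 → ℤ) × (Fin 4 → ℤ) => coeffGram c p.1 p.2 *
        ((-(Real.pi ^ 2 * (latticePairing p.1 v * latticePairing p.2 w)) : ℝ) : ℂ))
      (fun p => p.1 + p.2) _ fun u => ?_
    rw [← hiso u v w, ofReal_inner_eq_coeffGram (hd u v) (hd u w)]
    refine Finset.sum_congr rfl fun p _ => ?_
    rw [expWave_add_left]
    push_cast
    linear_combination (-(coeffGram c p.1 p.2 * Real.pi ^ 2 * latticePairing p.1 v *
      latticePairing p.2 w * expWave p.1 u * expWave p.2 u)) * Complex.I_sq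
  have hpi : ((Real.pi : ℂ)) ^ 2 ≠ 0 := by
    have := Real.pi_ne_zero
    exact pow_ne_zero 2 (by exact_mod_cast this)
  have h0 : ∀ k ∈ shortVectors, ∀ l ∈ shortVectors, l ≠ -k → coeffGram c k l = 0 := by
    intro k hk l hl hkl
    refine eq_zero_of_sum_fiber (coeffGram_comm c) (fun q hq => by rw [f1, if_neg hq])
      (fun q hq e => ?_) hk hl hkl
    have := f2 (intVector e) (intVector e) q
    rw [if_neg hq] at this
    simp only [latticePairing_intVector] at this
    apply mul_left_cancel₀ (neg_ne_zero.mpr hpi)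
    rw [mul_zero, ← this, Finset.mul_sum]
    refine Finset.sum_congr rfl fun p _ => ?_
    push_cast
    ring
  refine ⟨h0, fun v w => ?_, fun u v => ?_⟩
  · have := f2 v w 0
    rw [if_pos rfl, sum_fiber_zero (fun k l => coeffGram c k l *
        ((-(Real.pi ^ 2 * (latticePairing k v * latticePairing l w)) : ℝ) : ℂ))] at this
    rw [← Complex.ofReal_inj, ← this]
    push_cast
    rw [Finset.mul_sum]
    refine Finset.sum_congr rfl fun k _ => ?_
    rw [hw, latticePairing_neg_left]
    push_cast
    ring
  · rw [hin]
    rw [← Finset.sum_subset (Finset.filter_subset (fun p => p.1 + p.2 = 0) _),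
      sum_fiber_zero (fun k l => coeffGram c k l * (expWave k u * expWave l v))]
    · refine Finset.sum_congr rfl fun k _ => ?_
      rw [hw, sub_eq_add_neg, expWave_add_right]
      congr 2
      simp [expWave, latticePairing]
    · rintro ⟨k, l⟩ hp hp'
      simp only [Finset.mem_product, Finset.mem_filter, not_and] at hp hp'
      rw [h0 k hp.1 l hp.2 fun e => hp' hp (by rw [e, add_neg_cancel]), zero_mul]

/-! ### The weights and the kernel of an immersion -/

theorem sum_shortVectors {M : Type*} [AddCommMonoid M] (g : (Fin 4 → ℤ) → M) :
    ∑ k ∈ shortVectors, g k = ∑ j, (g (familyFrequency j) + g (-familyFrequency j)) := by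
  have h1 : shortVectors = Finset.univ.image familyFrequency ∪
      Finset.univ.image (fun j => -familyFrequency j) := by decide +kernel
  have hd : Disjoint (Finset.univ.image familyFrequency)
      (Finset.univ.image fun j => -familyFrequency j) := by decide +kernel
  have hi : Function.Injective familyFrequency := by decide +kernel
  rw [h1, Finset.sum_union hd, Finset.sum_image fun i _ j _ h => hi h,
    Finset.sum_image fun i _ j _ h => hi (neg_injective h), Finset.sum_add_distrib]

/-- The sum of the cosines of the phases, with weights constant on the three frames. -/
def familyKernel (A₁ A₂ A₃ : ℝ) (t : Euc 4) : ℝ :=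
  ∑ j, familyModulus A₁ A₂ A₃ j * Real.cos (familyPhase t j)

theorem inner_familyPoint (a₁ a₂ a₃ : ℝ) (u v : Euc 4) :
    inner ℝ (familyPoint a₁ a₂ a₃ u) (familyPoint a₁ a₂ a₃ v) =
      familyKernel (a₁ ^ 2) (a₂ ^ 2) (a₃ ^ 2) (u - v) := by
  rw [PiLp.inner_apply, ← (finProdFinEquiv (m := 12) (n := 2)).sum_comp, Fintype.sum_prod_type,
    familyKernel]
  refine Finset.sum_congr rfl fun j _ => ?_
  rw [Fin.sum_univ_two, familyPoint_apply, familyPoint_apply, familyPoint_apply,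
    familyPoint_apply, familyPhase_eq, latticePairing_sub_right, mul_sub, Real.cos_sub]
  have h1 : familyModulus (a₁ ^ 2) (a₂ ^ 2) (a₃ ^ 2) j = familyModulus a₁ a₂ a₃ j ^ 2 := by
    fin_cases j <;> rfl
  rw [h1]
  simp [cosWave, Real.cos_sub_pi_div_two]
  ring

theorem expWave_add_expWave_neg (k : Fin 4 → ℤ) (u : Euc 4) :
    expWave k u + expWave (-k) u = ((2 * Real.cos (Real.pi * latticePairing k u) : ℝ) : ℂ) := by
  rw [expWave, expWave, latticePairing_neg_left]
  push_cast
  rw [Complex.two_cos]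
  congr 2 <;> ring

/-- The weights of a `λ₁`-minimal isometric immersion. -/
theorem IsLambdaOneMinimal.exists_kernel {m : ℕ} {r : ℝ} (hr : 0 < r)
    {x : FlatTorus exceptionalLattice → UnitSphere m}
    (h : IsLambdaOneMinimal exceptionalLattice r x) :
    r = Real.pi ∧ ∃ A₁ A₂ A₃ : ℝ, 0 ≤ A₁ ∧ 0 ≤ A₂ ∧ 0 ≤ A₃ ∧ A₁ + A₂ + A₃ = 1 / 4 ∧
      ∀ u v, inner ℝ (torusLift x u) (torusLift x v) = familyKernel A₁ A₂ A₃ (u - v) := by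
  obtain ⟨μ, hμ, he⟩ := h.firstEigenfunctions
  have hμ' : μ * r ^ 2 = 4 * Real.pi ^ 2 := by
    rw [hμ.unique (isFirstEigenvalue_exceptionalLattice hr)]
    field_simp
  have hn : ∀ u, ‖torusLift x u‖ = 1 := fun u => 
    mem_sphere_zero_iff_norm.mp (x (QuotientAddGroup.mk u)).2
  let c : Fin (m + 1) → (Fin 4 → ℤ) → ℂ := fun i k => waveCoeff (fun u => torusLift x u i) k
  obtain ⟨-, hq, hk⟩ := coeffGram_of_isIsometricImmersion (c := c) h.smooth h.isometric hn
    (fun i u => (he i).expansion hr hμ' u) (fun i k => waveCoeff_neg _ k)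
  have hwneg : ∀ k, coeffWeight c (-k) = coeffWeight c k := fun k => by
    simp [coeffWeight, c, waveCoeff_neg]
  have hw0 : ∀ k, 0 ≤ coeffWeight c k := fun k =>
    Finset.sum_nonneg fun i _ => Complex.normSq_nonneg _
  set N : Fin 12 → ℝ := fun j => 2 * coeffWeight c (familyFrequency j) with hN
  have hN0 : ∀ j, 0 ≤ N j := fun j => mul_nonneg zero_le_two (hw0 _)
  have hq' : ∀ v w, Real.pi ^ 2 * ∑ j, N j *
      (latticePairing (familyFrequency j) v * latticePairing (familyFrequency j) w) =
      r ^ 2 * inner ℝ v w := by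
    intro v w
    rw [← hq, sum_shortVectors]
    congr 1
    refine Finset.sum_congr rfl fun j _ => ?_
    rw [hwneg, latticePairing_neg_left, latticePairing_neg_left]
    ring
  have hk' : ∀ u v, inner ℝ (torusLift x u) (torusLift x v) =
      ∑ j, N j * Real.cos (familyPhase (u - v) j) := by
    intro u v
    rw [← Complex.ofReal_inj, hk, sum_shortVectors]
    push_cast
    refine Finset.sum_congr rfl fun j _ => ?_
    rw [hwneg, ← mul_add, expWave_add_expWave_neg, familyPhase_eq, hN]
    push_cast
    ring
  have hsum : ∑ j, N j = 1 := by
    have := hk' 0 0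
    rw [real_inner_self_eq_norm_sq, hn] at this
    simpa [familyPhase_eq, latticePairing] using this.symm
  have hb : ∀ i i' : Fin 4, Real.pi ^ 2 *
      ∑ j, N j * ((familyFrequency j i : ℝ) * familyFrequency j i') =
      r ^ 2 * if i = i' then 1 else 0 := by
    intro i i'
    have := hq' (EuclideanSpace.single i 1) (EuclideanSpace.single i' 1)
    simpa [latticePairing, eq_comm, EuclideanSpace.inner_single_left, Pi.single_apply] using this
  -- The trace: every frequency has squared length 4, so the left side is 4π² times the total weight
  -- 1, and the right side is 4r².
  have hrpi : r = Real.pi := by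
    have e := congrArg₂ (· + ·) (congrArg₂ (· + ·) (hb 0 0) (hb 1 1))
      (congrArg₂ (· + ·) (hb 2 2) (hb 3 3))
    simp only [Fin.sum_univ_succ, familyFrequency] at e hsum
    simp at e hsum
    have e2 : Real.pi ^ 2 * 4 = r ^ 2 * 4 := by
      linear_combination e - 4 * Real.pi ^ 2 * hsum
    nlinarith [Real.pi_pos]
  have hpi : Real.pi ^ 2 ≠ 0 := by positivity
  have hb' : ∀ i i' : Fin 4,
      ∑ j, N j * ((familyFrequency j i : ℝ) * familyFrequency j i') =
      if i = i' then 1 else 0 := fun i i' => by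
    apply mul_left_cancel₀ hpi
    rw [hb, hrpi]
  -- The diagonal equations make the weights of the frame 2eᵢ equal. The six off-diagonal ones say
  -- that the other eight weights, as an even function of the signs in {±1}⁴, are orthogonal to all
  -- products of two distinct coordinates; what remains is a combination of 1 and x₀x₁x₂x₃, constant
  -- on each of the other two frames.
  have b00 := hb' 0 0
  have b11 := hb' 1 1
  have b22 := hb' 2 2
  have b33 := hb' 3 3
  have b01 := hb' 0 1
  have b02 := hb' 0 2
  have b03 := hb' 0 3
  have b12 := hb' 1 2
  have b13 := hb' 1 3
  have b23 := hb' 2 3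
  simp only [Fin.sum_univ_succ, familyFrequency] at b00 b11 b22 b33 b01 b02 b03 b12 b13 b23 hsum
  simp at b00 b11 b22 b33 b01 b02 b03 b12 b13 b23 hsum
  -- One representative index from each frame.
  refine ⟨hrpi, N 0, N 4, N 8, hN0 _, hN0 _, hN0 _, ?_, fun u v => ?_⟩
  · linarith
  · rw [hk', familyKernel]
    refine Finset.sum_congr rfl fun j _ => ?_
    congr 1
    fin_cases j <;> simp [familyModulus] <;> linarith

/-! ### From equal kernels and lattice symmetries to congruences -/

/-- Two families of vectors with the same Gram matrix differ by a linear isometry. -/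
theorem exists_linearIsometryEquiv_of_inner_eq {ι E : Type*} [NormedAddCommGroup E]
    [InnerProductSpace ℝ E] [FiniteDimensional ℝ E] (X Y : ι → E)
    (h : ∀ p q, inner ℝ (X p) (X q) = inner ℝ (Y p) (Y q)) :
    ∃ C : E ≃ₗᵢ[ℝ] E, ∀ p, Y p = C (X p) := by
  let LX : (ι →₀ ℝ) →ₗ[ℝ] E := Finsupp.linearCombination ℝ X
  let LY : (ι →₀ ℝ) →ₗ[ℝ] E := Finsupp.linearCombination ℝ Y
  have hin : ∀ f, inner ℝ (LX f) (LX f) = inner ℝ (LY f) (LY f) := by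
    intro f
    simp only [LX, LY, Finsupp.linearCombination_apply, Finsupp.sum, sum_inner, inner_sum,
      inner_smul_left, inner_smul_right, h]
  have hnorm : ∀ f, ‖LX f‖ = ‖LY f‖ := fun f => by
    have := hin f
    rw [real_inner_self_eq_norm_sq, real_inner_self_eq_norm_sq] at this
    exact (sq_eq_sq₀ (norm_nonneg _) (norm_nonneg _)).mp this
  -- The isometry on the span of `X` is `LY` composed with a section of `LX`; equality of norms
  -- makes the choice of section immaterial.
  obtain ⟨s, hs⟩ := LX.rangeRestrict.exists_rightInverse_of_surjective LX.range_rangeRestrict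
  have hs' : ∀ z : LinearMap.range LX, LX (s z) = z := fun z =>
    congrArg Subtype.val (LinearMap.congr_fun hs z)
  let L : LinearMap.range LX →ₗᵢ[ℝ] E :=
    { toLinearMap := LY.comp s
      norm_map' := fun z => by
        change ‖LY (s z)‖ = ‖z‖
        rw [← hnorm, hs']
        rfl }
  refine ⟨L.extend.toLinearIsometryEquiv rfl, fun p => ?_⟩
  have hp : LX (Finsupp.single p 1) = X p := by simp [LX]
  have hq : LY (Finsupp.single p 1) = Y p := by simp [LY]
  let z : LinearMap.range LX := ⟨X p, Finsupp.single p 1, hp⟩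
  have h1 : L.extend (X p) = L z := L.extend_apply z
  rw [LinearIsometry.coe_toLinearIsometryEquiv, h1]
  change Y p = LY (s z)
  have h2 : ‖LX (s z - Finsupp.single p 1)‖ = 0 := by
    rw [map_sub, hs', hp, sub_self, norm_zero]
  rw [hnorm, norm_eq_zero, map_sub, hq] at h2
  exact (sub_eq_zero.mp h2).symm

/-- A linear isometry preserving the lattice descends to an isometry of the torus. -/
theorem exists_isometryEquiv_of_linearIsometryEquiv {n : ℕ} {Λ : AddSubgroup (Euc n)}
    (L : Euc n ≃ₗᵢ[ℝ] Euc n) (hL : ∀ v, L v ∈ Λ ↔ v ∈ Λ) :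
    ∃ φ : FlatTorus Λ ≃ᵢ FlatTorus Λ,
      ∀ u : Euc n, φ (QuotientAddGroup.mk u) = QuotientAddGroup.mk (L u) := by
  have hmap : AddSubgroup.map (L.toLinearEquiv.toAddEquiv : Euc n →+ Euc n) Λ = Λ := by
    ext v
    rw [AddSubgroup.mem_map]
    constructor
    · rintro ⟨w, hw, rfl⟩
      exact (hL w).mpr hw
    · intro hv
      exact ⟨L.symm v, (hL _).mp (by simpa using hv), L.apply_symm_apply v⟩
  let e : FlatTorus Λ ≃+ FlatTorus Λ := QuotientAddGroup.congr Λ Λ L.toLinearEquiv.toAddEquiv hmap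
  have he : ∀ u : Euc n, e (QuotientAddGroup.mk u) = QuotientAddGroup.mk (L u) := fun u => rfl
  -- The quotient norm is the infimum over representatives, and `L` matches the representatives of
  -- `p` with those of `e p` isometrically.
  have hnorm : ∀ p, ‖e p‖ = ‖p‖ := by
    intro p
    obtain ⟨u, rfl⟩ := QuotientAddGroup.mk_surjective p
    refine le_antisymm ?_ ?_
    · rw [QuotientAddGroup.le_norm_iff]
      intro w hw
      rw [← hw, he, ← L.norm_map w]
      exact QuotientAddGroup.norm_mk_le_norm
    · rw [QuotientAddGroup.le_norm_iff]
      intro w hw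
      have h1 : (QuotientAddGroup.mk u : FlatTorus Λ) = QuotientAddGroup.mk (L.symm w) := by
        apply e.injective
        rw [← hw, he, L.apply_symm_apply]
      rw [h1, ← L.symm.norm_map w]
      exact QuotientAddGroup.norm_mk_le_norm
  refine ⟨⟨e.toEquiv, ?_⟩, he⟩
  refine Isometry.of_dist_eq fun p q => ?_
  change dist (e p) (e q) = dist p q
  rw [dist_eq_norm, dist_eq_norm, ← map_sub, hnorm]

/-! ### Symmetries of the lattice permuting the three frames -/

/-- The reflection in the last coordinate. -/
def reflectLast : Euc 4 →ₗ[ℝ] Euc 4 where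
  toFun u := !₂[u 0, u 1, u 2, -u 3]
  map_add' u v := by ext i; fin_cases i <;> simp; ring
  map_smul' c u := by ext i; fin_cases i <;> simp

/-- Half of a Hadamard matrix of order four. -/
def halfHadamard : Euc 4 →ₗ[ℝ] Euc 4 where
  toFun u := !₂[(u 0 + u 1 + u 2 + u 3) / 2, (u 0 + u 1 - u 2 - u 3) / 2,
    (u 0 - u 1 + u 2 - u 3) / 2, (u 0 - u 1 - u 2 + u 3) / 2]
  map_add' u v := by ext i; fin_cases i <;> simp <;> ring
  map_smul' c u := by ext i; fin_cases i <;> simp <;> ring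

/-- A norm preserving linear involution as a linear isometry. -/
def isometryOfInvolution (L : Euc 4 →ₗ[ℝ] Euc 4) (h2 : ∀ u, L (L u) = u)
    (hn : ∀ u, ‖L u‖ = ‖u‖) : Euc 4 ≃ₗᵢ[ℝ] Euc 4 :=
  ⟨LinearEquiv.ofInvolutive L h2, hn⟩

theorem reflectLast_involutive (u : Euc 4) : reflectLast (reflectLast u) = u := by
  ext i; fin_cases i <;> simp [reflectLast]

theorem halfHadamard_involutive (u : Euc 4) : halfHadamard (halfHadamard u) = u := by
  ext i; fin_cases i <;> simp [halfHadamard] <;> ring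

theorem norm_reflectLast (u : Euc 4) : ‖reflectLast u‖ = ‖u‖ := by
  rw [EuclideanSpace.norm_eq, EuclideanSpace.norm_eq]
  congr 1
  simp [Fin.sum_univ_four, reflectLast]

theorem norm_halfHadamard (u : Euc 4) : ‖halfHadamard u‖ = ‖u‖ := by
  rw [EuclideanSpace.norm_eq, EuclideanSpace.norm_eq]
  congr 1
  simp [Fin.sum_univ_four, halfHadamard]
  ring

theorem reflectLast_mem {v : Euc 4} (hv : v ∈ exceptionalLattice) :
    reflectLast v ∈ exceptionalLattice := by
  rw [mem_exceptionalLattice_iff] at hv ⊢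
  obtain ⟨k, ⟨m, hm⟩, hk⟩ := hv
  rw [Fin.sum_univ_four] at hm
  refine ⟨![k 0, k 1, k 2, -k 3], ⟨m - k 3, ?_⟩, fun i => ?_⟩
  · simp [Fin.sum_univ_four]
    linarith
  · fin_cases i <;> simp [reflectLast, hk]

theorem halfHadamard_mem {v : Euc 4} (hv : v ∈ exceptionalLattice) :
    halfHadamard v ∈ exceptionalLattice := by
  rw [mem_exceptionalLattice_iff] at hv ⊢
  obtain ⟨k, ⟨m, hm⟩, hk⟩ := hv
  rw [Fin.sum_univ_four] at hm
  have hm' : (k 0 + k 1 + k 2 + k 3 : ℝ) = m + m := by exact_mod_cast hm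
  refine ⟨![m, m - k 2 - k 3, m - k 1 - k 3, m - k 1 - k 2],
    ⟨2 * m - k 1 - k 2 - k 3, ?_⟩, fun i => ?_⟩
  · simp [Fin.sum_univ_four]
    ring
  · fin_cases i <;> simp [halfHadamard, hk] <;> linarith

/-- Cosine is even, so it suffices to permute the frequencies up to sign. -/
theorem familyKernel_eq_of_permutation {A₁ A₂ A₃ B₁ B₂ B₃ : ℝ} {s t : Euc 4}
    {σ : Fin 12 → Fin 12} (hσ : Function.Involutive σ)
    (hm : ∀ j, familyModulus A₁ A₂ A₃ j = familyModulus B₁ B₂ B₃ (σ j))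
    (h : ∀ j, familyPhase s j = familyPhase t (σ j) ∨ familyPhase s j = -familyPhase t (σ j)) :
    familyKernel A₁ A₂ A₃ s = familyKernel B₁ B₂ B₃ t := by
  rw [familyKernel, familyKernel, ← Equiv.sum_comp hσ.toPerm
    (fun j => familyModulus B₁ B₂ B₃ j * Real.cos (familyPhase t j))]
  refine Finset.sum_congr rfl fun j _ => ?_
  rw [hm, Function.Involutive.coe_toPerm]
  rcases h j with e | e
  · rw [e]
  · rw [e, Real.cos_neg]

theorem familyKernel_reflectLast (A₁ A₂ A₃ : ℝ) (t : Euc 4) :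
    familyKernel A₁ A₂ A₃ (reflectLast t) = familyKernel A₂ A₁ A₃ t := by
  refine familyKernel_eq_of_permutation (σ := ![4, 5, 6, 7, 0, 1, 2, 3, 8, 9, 10, 11])
    (by unfold Function.Involutive; decide) (fun j => by fin_cases j <;> simp [familyModulus]) fun j => ?_
  fin_cases j <;> simp [familyPhase, reflectLast] <;>
    first
    | exact Or.inl (by ring1)
    | exact Or.inr (by ring1)

theorem familyKernel_halfHadamard (A₁ A₂ A₃ : ℝ) (t : Euc 4) :
    familyKernel A₁ A₂ A₃ (halfHadamard t) = familyKernel A₃ A₂ A₁ t := by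
  refine familyKernel_eq_of_permutation (σ := ![8, 9, 10, 11, 4, 5, 6, 7, 0, 1, 2, 3])
    (by unfold Function.Involutive; decide) (fun j => by fin_cases j <;> simp [familyModulus]) fun j => ?_
  fin_cases j <;> simp [familyPhase, halfHadamard] <;>
    first
    | exact Or.inl (by ring1)
    | exact Or.inr (by ring1)

/-- The weights can be sorted by a linear isometry preserving the lattice. -/
def CanSort (A₁ A₂ A₃ : ℝ) : Prop :=
  ∃ (L : Euc 4 ≃ₗᵢ[ℝ] Euc 4) (B₁ B₂ B₃ : ℝ), (∀ v, L v ∈ exceptionalLattice ↔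
    v ∈ exceptionalLattice) ∧ 0 ≤ B₁ ∧ B₁ ≤ B₂ ∧ B₂ ≤ B₃ ∧ B₁ + B₂ + B₃ = 1 / 4 ∧
    ∀ t, familyKernel B₁ B₂ B₃ (L t) = familyKernel A₁ A₂ A₃ t

theorem CanSort.of_involution {L : Euc 4 →ₗ[ℝ] Euc 4} (h2 : ∀ u, L (L u) = u)
    (hn : ∀ u, ‖L u‖ = ‖u‖) (hm : ∀ v ∈ exceptionalLattice, L v ∈ exceptionalLattice)
    {A₁ A₂ A₃ B₁ B₂ B₃ : ℝ} (hA : CanSort A₁ A₂ A₃)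
    (h : ∀ t, familyKernel A₁ A₂ A₃ (L t) = familyKernel B₁ B₂ B₃ t) : CanSort B₁ B₂ B₃ := by
  obtain ⟨M, C₁, C₂, C₃, hM, h0, h12, h23, hs, hk⟩ := hA
  refine ⟨(isometryOfInvolution L h2 hn).trans M, C₁, C₂, C₃, fun v => ?_, h0, h12, h23, hs,
    fun t => ?_⟩
  · change M (L v) ∈ exceptionalLattice ↔ _
    rw [hM]
    exact ⟨fun hv => h2 v ▸ hm _ hv, hm v⟩
  · change familyKernel C₁ C₂ C₃ (M (L t)) = _
    rw [hk, h]

theorem CanSort.swap₁₂ {A₁ A₂ A₃ : ℝ} (h : CanSort A₁ A₂ A₃) : CanSort A₂ A₁ A₃ :=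
  h.of_involution reflectLast_involutive norm_reflectLast (fun _ => reflectLast_mem)
    (familyKernel_reflectLast A₁ A₂ A₃)

theorem CanSort.swap₁₃ {A₁ A₂ A₃ : ℝ} (h : CanSort A₁ A₂ A₃) : CanSort A₃ A₂ A₁ :=
  h.of_involution halfHadamard_involutive norm_halfHadamard (fun _ => halfHadamard_mem)
    (familyKernel_halfHadamard A₁ A₂ A₃)

/-- Conjugating one transposition by the other gives the third, so all orderings are reached. -/
theorem CanSort.swap₂₃ {A₁ A₂ A₃ : ℝ} (h : CanSort A₁ A₂ A₃) : CanSort A₁ A₃ A₂ :=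
  h.swap₁₃.swap₁₂.swap₁₃

theorem canSort_of_le {A₁ A₂ A₃ : ℝ} (h0 : 0 ≤ A₁) (h12 : A₁ ≤ A₂) (h23 : A₂ ≤ A₃)
    (hs : A₁ + A₂ + A₃ = 1 / 4) : CanSort A₁ A₂ A₃ :=
  ⟨LinearIsometryEquiv.refl ℝ _, A₁, A₂, A₃, fun _ => Iff.rfl, h0, h12, h23, hs, fun _ => rfl⟩

theorem canSort {A₁ A₂ A₃ : ℝ} (h1 : 0 ≤ A₁) (h2 : 0 ≤ A₂) (h3 : 0 ≤ A₃)
    (hs : A₁ + A₂ + A₃ = 1 / 4) : CanSort A₁ A₂ A₃ := by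
  rcases le_total A₁ A₂ with h12 | h12 <;> rcases le_total A₂ A₃ with h23 | h23 <;>
    rcases le_total A₁ A₃ with h13 | h13
  · exact canSort_of_le h1 h12 h23 hs
  · exact canSort_of_le h1 h12 h23 hs
  · exact (canSort_of_le h1 h13 h23 (by linarith)).swap₂₃
  · exact (canSort_of_le h3 h13 h12 (by linarith)).swap₁₂.swap₂₃
  · exact (canSort_of_le h2 h12 h13 (by linarith)).swap₁₂
  · exact (canSort_of_le h2 h23 h13 (by linarith)).swap₂₃.swap₁₂
  · exact (canSort_of_le h3 h23 h12 (by linarith)).swap₁₃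
  · exact (canSort_of_le h3 h23 h12 (by linarith)).swap₁₃

theorem exists_isCongruent_exceptionalFamily {r : ℝ} (hr : 0 < r)
    {x : FlatTorus exceptionalLattice → UnitSphere 23}
    (h : IsLambdaOneMinimal exceptionalLattice r x) :
    r = Real.pi ∧ ∃ (a₁ a₂ a₃ : ℝ) (h : IsParameter a₁ a₂ a₃),
      IsCongruent x (exceptionalFamily h) := by
  obtain ⟨hrpi, A₁, A₂, A₃, h1, h2, h3, hs, hk⟩ := h.exists_kernel hr
  obtain ⟨L, B₁, B₂, B₃, hL, g0, g12, g23, gs, gk⟩ := canSort h1 h2 h3 hs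
  have e1 : √B₁ ^ 2 = B₁ := Real.sq_sqrt g0
  have e2 : √B₂ ^ 2 = B₂ := Real.sq_sqrt (g0.trans g12)
  have e3 : √B₃ ^ 2 = B₃ := Real.sq_sqrt ((g0.trans g12).trans g23)
  have hp : IsParameter √B₁ √B₂ √B₃ :=
    ⟨Real.sqrt_nonneg _, Real.sqrt_le_sqrt g12, Real.sqrt_le_sqrt g23, by rw [e1, e2, e3, gs]⟩
  refine ⟨hrpi, _, _, _, hp, ?_⟩
  obtain ⟨φ, hφ⟩ := exists_isometryEquiv_of_linearIsometryEquiv L hL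
  -- After composing the sorted model with `φ`, both maps have the same Gram kernel.
  obtain ⟨C, hC⟩ := exists_linearIsometryEquiv_of_inner_eq
    (fun p => (x p : Euc 24)) (fun p => (exceptionalFamily hp (φ p) : Euc 24)) fun p q => by
      obtain ⟨u, rfl⟩ := QuotientAddGroup.mk_surjective p
      obtain ⟨v, rfl⟩ := QuotientAddGroup.mk_surjective q
      rw [hφ, hφ]
      change inner ℝ (torusLift x u) (torusLift x v) =
        inner ℝ (familyPoint √B₁ √B₂ √B₃ (L u)) (familyPoint √B₁ √B₂ √B₃ (L v))
      rw [hk, inner_familyPoint, e1, e2, e3, ← map_sub, gk]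
  exact ⟨φ, C, hC⟩

/-! ### Deep holes and the distinctness of the parameters -/

/-- The three deep holes of the lattice. -/
def deepHole : Fin 3 → Euc 4 :=
  ![!₂[1 / 2, 1 / 2, 1 / 2, 1 / 2], !₂[1 / 2, 1 / 2, 1 / 2, -1 / 2], !₂[0, 0, 0, 1]]

theorem norm_sq_euc (v : Euc 4) : ‖v‖ ^ 2 = v 0 ^ 2 + v 1 ^ 2 + v 2 ^ 2 + v 3 ^ 2 := by
  rw [EuclideanSpace.norm_sq_eq]
  simp [Fin.sum_univ_four]

/-- The cosines of the phases at the deep holes. -/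
def deepHoleSign : Fin 3 → Fin 12 → ℝ :=
  ![![1, 1, 1, 1, -1, -1, -1, -1, -1, -1, -1, -1], ![-1, -1, -1, -1, 1, 1, 1, 1, -1, -1, -1, -1],
    ![-1, -1, -1, -1, -1, -1, -1, -1, 1, 1, 1, 1]]

theorem cos_familyPhase_deepHole (i : Fin 3) (j : Fin 12) :
    Real.cos (familyPhase (deepHole i) j) = deepHoleSign i j := by
  have e0 : ∀ x : ℝ, x = 0 → Real.cos x = 1 := fun x h => by rw [h, Real.cos_zero]
  have e1 : ∀ x : ℝ, x = Real.pi → Real.cos x = -1 := fun x h => by rw [h, Real.cos_pi]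
  have e2 : ∀ x : ℝ, x = -Real.pi → Real.cos x = -1 := fun x h => by
    rw [h, Real.cos_neg, Real.cos_pi]
  have e3 : ∀ x : ℝ, x = 2 * Real.pi → Real.cos x = 1 := fun x h => by rw [h, Real.cos_two_pi]
  fin_cases i <;> fin_cases j <;> simp [familyPhase, deepHole, deepHoleSign] <;>
    first
    | exact e0 _ (by ring1)
    | exact e1 _ (by ring1)
    | exact e2 _ (by ring1)
    | exact e3 _ (by ring1)

theorem familyKernel_deepHole (A : Fin 3 → ℝ) (i : Fin 3) :
    familyKernel (A 0) (A 1) (A 2) (deepHole i) = 8 * A i - 4 * (A 0 + A 1 + A 2) := by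
  simp only [familyKernel, cos_familyPhase_deepHole, Fin.sum_univ_succ, familyModulus,
    deepHoleSign]
  fin_cases i <;> simp <;> ring

/-- The parity of the sum of the `n i` decides between the two half-integral holes. -/
theorem exists_deepHole_of_half {u : Euc 4} {n : Fin 4 → ℤ} (hn : ∀ i, u i = n i + 1 / 2) :
    ∃ i, u - deepHole i ∈ exceptionalLattice := by
  rcases Int.even_or_odd (∑ i, n i) with he | ho
  · refine ⟨0, (mem_exceptionalLattice_iff _).mpr ⟨n, he, fun i => ?_⟩⟩
    fin_cases i <;> simp [deepHole, hn]
  · refine ⟨1, (mem_exceptionalLattice_iff _).mpr ⟨![n 0, n 1, n 2, n 3 + 1], ?_, fun i => ?_⟩⟩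
    · obtain ⟨m, hm⟩ := ho
      rw [Fin.sum_univ_four] at hm
      refine ⟨m + 1, ?_⟩
      simp [Fin.sum_univ_four]
      linarith
    · fin_cases i <;> simp [deepHole, hn]
      ring

theorem exists_int_add_half {z : Fin 4 → ℤ} {u : Euc 4} (h : ∀ i, |u i - z i| = 1 / 2) :
    ∃ n : Fin 4 → ℤ, ∀ i, u i = n i + 1 / 2 := by
  have : ∀ i, ∃ n : ℤ, u i = n + 1 / 2 := by
    intro i
    rcases (abs_eq (by norm_num)).mp (h i) with e | e
    · exact ⟨z i, by linarith⟩
    · exact ⟨z i - 1, by push_cast; linarith⟩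
  choose n hn using this
  exact ⟨n, hn⟩

/-- A point at distance at least `1` from the lattice is equivalent to a deep hole. -/
theorem exists_deepHole {u : Euc 4} (h : ∀ v ∈ exceptionalLattice, 1 ≤ ‖u - v‖) :
    ∃ i, u - deepHole i ∈ exceptionalLattice := by
  have h' : ∀ k : Fin 4 → ℤ, Even (∑ i, k i) → 1 ≤ ∑ i, (u i - k i) ^ 2 := by
    intro k hk
    have h1 := h (intVector k) ((mem_exceptionalLattice_iff _).mpr ⟨k, hk, fun i => rfl⟩)
    have h2 : 1 ≤ ‖u - intVector k‖ ^ 2 := one_le_pow₀ h1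
    rw [EuclideanSpace.norm_sq_eq] at h2
    simpa [intVector] using h2
  set z : Fin 4 → ℤ := fun i => round (u i) with hz
  have hs : ∀ i, |u i - z i| ≤ 1 / 2 := fun i => abs_sub_round (u i)
  have hs2 : ∀ i, (u i - z i) ^ 2 ≤ |u i - z i| / 2 := fun i => by
    rw [← sq_abs]
    nlinarith [hs i, abs_nonneg (u i - z i)]
  rcases Int.even_or_odd (∑ i, z i) with he | ho
  -- The rounding `z` is a lattice point, and four squares of size at most 1/4 reach 1 only if all
  -- offsets are 1/2.
  · have h1 := h' z he
    rw [Fin.sum_univ_four] at h1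
    have h2 : ∀ i, |u i - z i| = 1 / 2 := by
      intro i
      refine le_antisymm (hs i) ?_
      fin_cases i <;> simp only [Fin.zero_eta, Fin.mk_one, Fin.reduceFinMk] <;>
        linarith [hs2 0, hs2 1, hs2 2, hs2 3, hs 0, hs 1, hs 2, hs 3]
    obtain ⟨n, hn⟩ := exists_int_add_half h2
    exact exists_deepHole_of_half hn
  -- Here `z` is not in the lattice, but moving one coordinate by ±1 puts it there; the better sign
  -- gives this inequality. Summed over `j` and combined with `hs2`, it forces equality throughout:
  -- the offsets tᵢ are all 0, giving the integral hole, or all 1/2.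
  · have h1 : ∀ j, 2 * |u j - z j| ≤ ∑ i, (u i - z i) ^ 2 := by
      intro j
      have aux : ∀ ε : ℤ, Odd ε → ε ^ 2 = 1 →
          2 * (ε * (u j - z j)) ≤ ∑ i, (u i - z i) ^ 2 := by
        intro ε hε hε2
        have hε2' : (ε : ℝ) ^ 2 = 1 := by exact_mod_cast hε2
        have h2 := h' (z + Pi.single j ε) (by
          simpa [Finset.sum_add_distrib] using ho.add_odd hε)
        have h3 : ∀ i, (u i - ((z + Pi.single j ε : Fin 4 → ℤ) i : ℤ)) ^ 2 =
            (u i - z i) ^ 2 + if i = j then 1 - 2 * (ε * (u j - z j)) else 0 := by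
          intro i
          by_cases hij : i = j
          · subst hij
            simp
            linear_combination hε2'
          · simp [hij]
        rw [Finset.sum_congr rfl fun i _ => h3 i, Finset.sum_add_distrib] at h2
        simp at h2
        linarith
      rcases abs_cases (u j - z j) with ⟨e, -⟩ | ⟨e, -⟩ <;> rw [e]
      · simpa using aux 1 (by decide) (by decide)
      · simpa using aux (-1) (by decide) (by decide)
    rw [Fin.sum_univ_four] at h1
    by_cases h0 : ∑ i, (u i - z i) ^ 2 = 0
    · have hz0 : ∀ i, u i = z i := fun i => by
        have := (Finset.sum_eq_zero_iff_of_nonneg fun i _ => sq_nonneg (u i - z i)).mp h0 i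
          (Finset.mem_univ i)
        exact sub_eq_zero.mp (pow_eq_zero_iff two_ne_zero |>.mp this)
      refine ⟨2, (mem_exceptionalLattice_iff _).mpr ⟨![z 0, z 1, z 2, z 3 - 1], ?_, fun i => ?_⟩⟩
      · obtain ⟨m, hm⟩ := ho
        rw [Fin.sum_univ_four] at hm
        refine ⟨m, ?_⟩
        simp [Fin.sum_univ_four]
        linarith
      · fin_cases i <;> simp [deepHole, hz0]
    · have hpos : 0 < ∑ i, (u i - z i) ^ 2 :=
        lt_of_le_of_ne (Finset.sum_nonneg fun i _ => sq_nonneg _) (Ne.symm h0)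
      rw [Fin.sum_univ_four] at hpos
      have heq : ∀ i, (u i - z i) ^ 2 = |u i - z i| / 2 ∧ 0 < |u i - z i| := by
        intro i
        constructor
        · refine le_antisymm (hs2 i) ?_
          fin_cases i <;> simp only [Fin.zero_eta, Fin.mk_one, Fin.reduceFinMk] <;>
            linarith [hs2 0, hs2 1, hs2 2, hs2 3, h1 0, h1 1, h1 2, h1 3]
        · fin_cases i <;> simp only [Fin.zero_eta, Fin.mk_one, Fin.reduceFinMk] <;>
            linarith [hs2 0, hs2 1, hs2 2, hs2 3, h1 0, h1 1, h1 2, h1 3]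
      have h2 : ∀ i, |u i - z i| = 1 / 2 := fun i => by
        obtain ⟨e, p⟩ := heq i
        rw [← sq_abs] at e
        apply mul_left_cancel₀ p.ne'
        linarith
      obtain ⟨n, hn⟩ := exists_int_add_half h2
      exact exists_deepHole_of_half hn

theorem quarter_le_sq_half_sub_int (k : ℤ) : (1 / 4 : ℝ) ≤ (1 / 2 - k) ^ 2 := by
  have h1 : 0 ≤ k * (k - 1) := by
    rcases le_or_gt k 0 with h | h
    · nlinarith
    · exact mul_nonneg h.le (by omega)
  have h2 : (0 : ℝ) ≤ k * (k - 1) := by exact_mod_cast h1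
  linarith

theorem one_le_norm_deepHole_sub (i : Fin 3) {v : Euc 4} (hv : v ∈ exceptionalLattice) :
    1 ≤ ‖deepHole i - v‖ := by
  obtain ⟨k, ⟨m, hm⟩, hk⟩ := (mem_exceptionalLattice_iff v).mp hv
  rw [Fin.sum_univ_four] at hm
  refine one_le_sq_iff₀ (norm_nonneg _) |>.mp ?_
  rw [norm_sq_euc]
  simp only [PiLp.sub_apply, hk]
  have q := quarter_le_sq_half_sub_int
  fin_cases i
  · simp [deepHole]
    linarith [q (k 0), q (k 1), q (k 2), q (k 3)]
  · have q3 := q (k 3 + 1)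
    simp [deepHole]
    push_cast at q3
    linarith [q (k 0), q (k 1), q (k 2)]
  · simp [deepHole]
    have h1 : 1 ≤ k 0 ^ 2 + k 1 ^ 2 + k 2 ^ 2 + (1 - k 3) ^ 2 := by
      by_contra hlt
      have z : ∀ x : ℤ, x ^ 2 ≤ 0 → x = 0 := fun x hx =>
        pow_eq_zero_iff two_ne_zero |>.mp (le_antisymm hx (sq_nonneg x))
      have p0 := sq_nonneg (k 0)
      have p1 := sq_nonneg (k 1)
      have p2 := sq_nonneg (k 2)
      have p3 := sq_nonneg (1 - k 3)
      have z0 := z (k 0) (by linarith)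
      have z1 := z (k 1) (by linarith)
      have z2 := z (k 2) (by linarith)
      have z3 := z (1 - k 3) (by linarith)
      omega
    exact_mod_cast h1

theorem deepHole_sub_mem_iff {i j : Fin 3} :
    deepHole i - deepHole j ∈ exceptionalLattice ↔ i = j := by
  refine ⟨fun h => ?_, fun h => by rw [h, sub_self]; exact zero_mem _⟩
  obtain ⟨k, ⟨m, hm⟩, hk⟩ := (mem_exceptionalLattice_iff _).mp h
  rw [Fin.sum_univ_four] at hm
  let D : Fin 3 → Fin 4 → ℤ := ![![1, 1, 1, 1], ![1, 1, 1, -1], ![0, 0, 0, 2]]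
  have hD : ∀ i l, 2 * deepHole i l = D i l := by
    intro i l
    fin_cases i <;> fin_cases l <;> simp [deepHole, D]
    ring
  have hk' : ∀ l, D i l - D j l = 2 * k l := fun l => by
    have h1 : (D i l : ℝ) - D j l = 2 * k l := by
      rw [← hk, ← hD, ← hD, PiLp.sub_apply]
      ring
    exact_mod_cast h1
  have k0 := hk' 0
  have k1 := hk' 1
  have k2 := hk' 2
  have k3 := hk' 3
  fin_cases i <;> fin_cases j <;> simp [D] at k0 k1 k2 k3 ⊢ <;> omega

theorem one_le_norm_mk_iff (u : Euc 4) :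
    1 ≤ ‖(QuotientAddGroup.mk u : FlatTorus exceptionalLattice)‖ ↔
      ∀ v ∈ exceptionalLattice, 1 ≤ ‖u - v‖ := by
  rw [QuotientAddGroup.le_norm_iff]
  constructor
  · intro h v hv
    exact h (u - v) (by rw [sub_eq_add_neg]; exact QuotientAddGroup.mk_add_of_mem u (neg_mem hv))
  · intro h w hw
    have := h (u - w) (QuotientAddGroup.eq_iff_sub_mem.mp hw.symm)
    rwa [sub_sub_cancel] at this

/-- Only distance preservation by `φ` is needed: it carries the deep holes around 0 to those around
φ(0), and `C` preserves the kernel values 8aᵢ² - 1 there. The squared parameters are thus permuted,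
and sorting removes the permutation. -/
theorem eq_of_isCongruent_exceptionalFamily {a₁ a₂ a₃ b₁ b₂ b₃ : ℝ} (h : IsParameter a₁ a₂ a₃)
    (h' : IsParameter b₁ b₂ b₃) (hc : IsCongruent (exceptionalFamily h) (exceptionalFamily h')) :
    a₁ = b₁ ∧ a₂ = b₂ ∧ a₃ = b₃ := by
  obtain ⟨φ, C, hC⟩ := hc
  let A : Fin 3 → ℝ := ![a₁ ^ 2, a₂ ^ 2, a₃ ^ 2]
  let B : Fin 3 → ℝ := ![b₁ ^ 2, b₂ ^ 2, b₃ ^ 2]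
  have hA : A 0 + A 1 + A 2 = 1 / 4 := h.sum_sq
  have hB : B 0 + B 1 + B 2 = 1 / 4 := h'.sum_sq
  have hker : ∀ u v u' v' : Euc 4, φ (QuotientAddGroup.mk u) = QuotientAddGroup.mk u' →
      φ (QuotientAddGroup.mk v) = QuotientAddGroup.mk v' →
      familyKernel (B 0) (B 1) (B 2) (u' - v') = familyKernel (A 0) (A 1) (A 2) (u - v) := by
    intro u v u' v' hu hv
    have h1 := C.inner_map_map (exceptionalFamily h (QuotientAddGroup.mk u) : Euc 24)
      (exceptionalFamily h (QuotientAddGroup.mk v) : Euc 24)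
    rw [← hC, ← hC, hu, hv] at h1
    change inner ℝ (familyPoint b₁ b₂ b₃ u') (familyPoint b₁ b₂ b₃ v') =
      inner ℝ (familyPoint a₁ a₂ a₃ u) (familyPoint a₁ a₂ a₃ v) at h1
    rwa [inner_familyPoint, inner_familyPoint] at h1
  obtain ⟨w, hw⟩ := QuotientAddGroup.mk_surjective (φ (QuotientAddGroup.mk 0))
  have hex : ∀ i, ∃ j, φ (QuotientAddGroup.mk (deepHole i)) =
      QuotientAddGroup.mk (deepHole j + w) ∧ B j = A i := by
    intro i
    obtain ⟨u', hu'⟩ := QuotientAddGroup.mk_surjective (φ (QuotientAddGroup.mk (deepHole i)))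
    -- A deep hole is at distance at least 1 from the origin of the torus, hence its image is at
    -- distance at least 1 from the image `w` of the origin.
    have hd : 1 ≤ ‖(QuotientAddGroup.mk (u' - w) : FlatTorus exceptionalLattice)‖ := by
      rw [QuotientAddGroup.mk_sub, hu', hw, ← dist_eq_norm, φ.dist_eq, dist_eq_norm,
        ← QuotientAddGroup.mk_sub, sub_zero, one_le_norm_mk_iff]
      exact fun v hv => one_le_norm_deepHole_sub i hv
    rw [one_le_norm_mk_iff] at hd
    obtain ⟨j, hj⟩ := exists_deepHole hd
    have hj' : φ (QuotientAddGroup.mk (deepHole i)) = QuotientAddGroup.mk (deepHole j + w) := by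
      rw [← hu']
      apply QuotientAddGroup.eq_iff_sub_mem.mpr
      rwa [← sub_sub, sub_right_comm]
    refine ⟨j, hj', ?_⟩
    have h1 := hker (deepHole i) 0 _ w hj' hw.symm
    rw [add_sub_cancel_right, sub_zero, familyKernel_deepHole, familyKernel_deepHole] at h1
    linarith
  choose σ hσ hBA using hex
  have hinj : Function.Injective σ := by
    intro i j hij
    have h1 : φ (QuotientAddGroup.mk (deepHole i)) = φ (QuotientAddGroup.mk (deepHole j)) := by
      rw [hσ, hσ, hij]
    exact deepHole_sub_mem_iff.mp (QuotientAddGroup.eq_iff_sub_mem.mp (φ.injective h1))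
  have hAm : A 0 ≤ A 1 ∧ A 1 ≤ A 2 :=
    ⟨pow_le_pow_left₀ h.nonneg h.le₁₂ 2, pow_le_pow_left₀ (h.nonneg.trans h.le₁₂) h.le₂₃ 2⟩
  have hBm : B 0 ≤ B 1 ∧ B 1 ≤ B 2 :=
    ⟨pow_le_pow_left₀ h'.nonneg h'.le₁₂ 2, pow_le_pow_left₀ (h'.nonneg.trans h'.le₁₂) h'.le₂₃ 2⟩
  have key : A 0 = B 0 ∧ A 1 = B 1 ∧ A 2 = B 2 := by
    have n01 : σ 0 ≠ σ 1 := hinj.ne (by decide)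
    have n02 : σ 0 ≠ σ 2 := hinj.ne (by decide)
    have n12 : σ 1 ≠ σ 2 := hinj.ne (by decide)
    have q0 := hBA 0
    have q1 := hBA 1
    have q2 := hBA 2
    obtain ⟨m1, m2⟩ := hAm
    obtain ⟨m3, m4⟩ := hBm
    generalize σ 0 = s0 at *
    generalize σ 1 = s1 at *
    generalize σ 2 = s2 at *
    fin_cases s0 <;> fin_cases s1 <;> fin_cases s2 <;> simp at n01 n02 n12 <;>
      simp only [Fin.zero_eta, Fin.mk_one, Fin.reduceFinMk] at q0 q1 q2 <;>
      exact ⟨by linarith, by linarith, by linarith⟩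
  have a2 := h.nonneg.trans h.le₁₂
  have b2 := h'.nonneg.trans h'.le₁₂
  exact ⟨(pow_left_inj₀ h.nonneg h'.nonneg two_ne_zero).mp key.1,
    (pow_left_inj₀ a2 b2 two_ne_zero).mp key.2.1,
    (pow_left_inj₀ (a2.trans h.le₂₃) (b2.trans h'.le₂₃) two_ne_zero).mp key.2.2⟩

theorem mainTheorem5 :
    (∀ (a₁ a₂ a₃ : ℝ) (h : IsParameter a₁ a₂ a₃),
      IsLambdaOneMinimal exceptionalLattice Real.pi (exceptionalFamily h)) ∧
    (∀ (r : ℝ) (_ : 0 < r) (x : FlatTorus exceptionalLattice → UnitSphere 23),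
      IsLambdaOneMinimal exceptionalLattice r x →
        r = Real.pi ∧ ∃ (a₁ a₂ a₃ : ℝ) (h : IsParameter a₁ a₂ a₃),
          IsCongruent x (exceptionalFamily h)) ∧
    (∀ (a₁ a₂ a₃ b₁ b₂ b₃ : ℝ) (h : IsParameter a₁ a₂ a₃) (h' : IsParameter b₁ b₂ b₃),
      IsCongruent (exceptionalFamily h) (exceptionalFamily h') →
        a₁ = b₁ ∧ a₂ = b₂ ∧ a₃ = b₃) :=
  ⟨fun _ _ _ h => isLambdaOneMinimal_exceptionalFamily h,
    fun _ hr _ h => exists_isCongruent_exceptionalFamily hr h,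
    fun _ _ _ _ _ _ h h' hc => eq_of_isCongruent_exceptionalFamily h h' hc⟩

end
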